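/- Let \textsc{Narrow Grid Tiling} be the following decision problem. An instance $(x,y,N,\mathcal S)$ consists of integers $x,y,N\ge 1$ and a collection $\mathcal S=\{S_{i,j}\}_{(i,j)\in[x]\times[y]}$ of non-empty sets $S_{i,j}\subseteq\{0,1\}\times[N]$, where $[m]=\{1,\dots,m\}$. The question is whether one can choose $s_{i,j}\in S_{i,j}$ for all $(i,j)\in[x]\times[y]$ such that $s_{i,j}$ and $s_{i+1,j}$ have the same first component whenever $1\le i<x$, $1\le j\le y$, and $s_{i,j}$ and $s_{i,j+1}$ have the same second component whenever $1\le i\le x$, $1\le j<y$. The Exponential Time Hypothesis (ETH) states that there is $\delta>0$ such that 3-SAT with $n$ variables (formulas being sets of clauses with at most three literals) cannot be solved in time $O(2^{\delta n})$. Algorithms are deterministic multi-tape Turing machines, and time is the number of steps. \textbf{Theorem.} Assume ETH. (1) For every $b>0$ there exists $\varepsilon>0$ such that for every $C>0$ there is no algorithm that solves every instance $(x,y,N,\mathcal S)$ of \textsc{Narrow Grid Tiling} in time $$C\cdot 2^{\varepsilon\,(xy+x^2\log_2 N)}\cdot N^{b}.$$ (2) In particular, there is no $2^{o(xy)}\cdot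 N^{O(1)}$ time algorithm for \textsc{Narrow Grid Tiling}: for every function $f:\mathbb N\to\mathbb R$ with $f(s)=o(s)$ as $s\to\infty$ and every real $b$, no algorithm solves every instance $(x,y,N,\mathcal S)$ in time $2^{f(xy)}\cdot N^{b}$. -/

import Mathlib

/-- The deterministic multi-stack Turing machine `M` (Mathlib's machine model, with input alphabet
`Γ` and output alphabet `Bool`) decides the problem `P` on the instances in `α`, presented to the
machine by the encoding `enc`: on every instance `a` it halts with the correct answer to
"does `P a` hold?" as its output, after at most `T a` steps. -/
def DecidesInTime {α Γ : Type} (M : Turing.TM2ComputableAux Γ Bool) (enc : α → List Γ)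
    (P : α → Prop) (T : α → ℝ) : Prop :=
  ∀ a : α, ∃ (ans : Bool) (t : ℕ), (ans = true ↔ P a) ∧ (t : ℝ) ≤ T a ∧
    Nonempty (Turing.TM2OutputsInTime M.tm
      (List.map M.inputAlphabet.invFun (enc a))
      (some (List.map M.outputAlphabet.invFun (Computability.encodeBool ans))) t)

/-- The problem `P`, with instances encoded by `enc`, can be solved by an algorithm that takes time
at most `T a` on every instance `a`. -/
def SolvableInTime {α Γ : Type} (enc : α → List Γ) (P : α → Prop) (T : α → ℝ) : Prop :=
  ∃ M : Turing.TM2ComputableAux Γ Bool, DecidesInTime M enc P T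

/-! ### 3-SAT and the Exponential Time Hypothesis -/

/-- A literal over the variables `0, …, n - 1`: a variable together with its sign
(`true` for `x`, `false` for `¬ x`). -/
abbrev Literal (n : ℕ) : Type := Fin n × Bool

/-- A 3-CNF formula with `numVars` variables. Each clause is a disjunction of three literals, which
may coincide, so that clauses with one or two distinct literals are included. A formula is
a set of clauses: no clause is listed twice. (If clauses could be repeated, the length of
the input would not be bounded in terms of the number of variables.) -/
structure ThreeCNF : Type where
  numVars : ℕ
  clauses : List (Fin 3 → Literal numVars)
  nodup : clauses.Nodup

namespace ThreeCNF

/-- Some assignment makes at least one literal of every clause true. -/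
def Satisfiable (φ : ThreeCNF) : Prop :=
  ∃ v : Fin φ.numVars → Bool, ∀ c ∈ φ.clauses, ∃ k : Fin 3, v (c k).1 = (c k).2

/-- A literal is encoded by the index of its variable in unary, a delimiter, and its sign. -/
def encodeLiteral {n : ℕ} (l : Literal n) : List Bool :=
  List.replicate l.1.val true ++ [false, l.2]

/-- The number of variables in unary and a delimiter, then the literals of all the clauses. -/
def encode (φ : ThreeCNF) : List Bool :=
  List.replicate φ.numVars true ++ [false] ++
    φ.clauses.flatMap fun c => (List.finRange 3).flatMap fun k => encodeLiteral (c k)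

end ThreeCNF

/-- The Exponential Time Hypothesis: there is `δ > 0` such that 3-SAT with `n` variables cannot be
solved in time `O(2 ^ (δ n))`. -/
def ExponentialTimeHypothesis : Prop :=
  ∃ δ : ℝ, 0 < δ ∧ ¬ ∃ C : ℝ,
    SolvableInTime ThreeCNF.encode ThreeCNF.Satisfiable
      fun φ => C * (2 : ℝ) ^ (δ * (φ.numVars : ℝ))

/-! ### Narrow Grid Tiling -/

/-- An instance of Narrow Grid Tiling: positive integers `x`, `y`, an integer `N`, and non-empty
sets `S i j ⊆ {0, 1} × [N]` for `(i, j) ∈ [x] × [y]`. (`N` is positive as well, because the sets are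
non-empty.) -/
structure NarrowGridTiling : Type where
  x : ℕ
  y : ℕ
  N : ℕ
  x_pos : 0 < x
  y_pos : 0 < y
  S : Fin x → Fin y → Finset (Bool × Fin N)
  nonempty : ∀ i j, (S i j).Nonempty

namespace NarrowGridTiling

/-- A choice of one pair per cell is consistent if each pair belongs to the set of its cell,
the pairs in the cells `(i, j)` and `(i + 1, j)` agree in the first component, and the pairs in
the cells `(i, j)` and `(i, j + 1)` agree in the second component. -/
structure Consistent (I : NarrowGridTiling) (s : Fin I.x → Fin I.y → Bool × Fin I.N) : Prop where
  mem : ∀ i j, s i j ∈ I.S i j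
  vertical : ∀ (i i' : Fin I.x) (j : Fin I.y), (i' : ℕ) = (i : ℕ) + 1 → (s i j).1 = (s i' j).1
  horizontal : ∀ (i : Fin I.x) (j j' : Fin I.y), (j' : ℕ) = (j : ℕ) + 1 → (s i j).2 = (s i j').2

/-- `I` is a yes-instance. -/
def IsYes (I : NarrowGridTiling) : Prop :=
  ∃ s, I.Consistent s

/-- The numbers `x`, `y`, `N` in unary, each followed by a delimiter, then for each cell, row
by row, the table of the `2 N` bits that tell which pairs belong to the set of that cell. -/
def encode (I : NarrowGridTiling) : List Bool :=
  List.replicate I.x true ++ [false] ++ List.replicate I.y true ++ [false] ++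
    List.replicate I.N true ++ [false] ++
    (List.finRange I.x).flatMap fun i => (List.finRange I.y).flatMap fun j =>
      [false, true].flatMap fun a => (List.finRange I.N).map fun v => decide ((a, v) ∈ I.S i j)

end NarrowGridTiling

/-! Fix a constant `k` and split the `n` variables into `k` classes of size at most `⌈n/k⌉`, by
position modulo `k`. The grid has a column for each variable plus a last column, and a row for each
triple of classes plus a special row. So `x = k³ + 1` is constant and `y = n + 1`. The bit shared by
a column is the truth value of its variable. The number shared by a row encodes a partial assignment
of the variables in its three classes, so `N = 2 ^ (3⌈n/k⌉)` values suffice. A cell in a variable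
column asks that the partial assignment allow the column's bit. In the last column the special row
forces the bit `false`, and under that bit every other row asks that its partial assignment leave
each clause a literal that it allows. Under the bit `true` these cells accept everything, so that no
set is empty even if the formula is unsatisfiable.

Each clause has a row whose classes contain its three variables. There every variable of the clause
has exactly one allowed value, so an allowed literal is a true one. Conversely, a satisfying
assignment restricts to every row. This is `tiling_isYes_iff`.

The instance is written in time polynomial in `n` times `N`, where `N ≤ 8 · 2 ^ (3n/k)`. For `k`
large in terms of `b` and `δ`, both `N` and `N ^ b` are at most a constant times `2 ^ (δn/4)`. As
`x` is now fixed, a small `ε` makes the remaining factor at most `C · 2 ^ (δ(n+1)/4)`, and 3-SAT is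
solved in time `O(2 ^ (δn))`, against ETH. Part (2) follows because `2 ^ f(s) = O(2 ^ (εs))`.

The time bound must hold for an actual machine. The reduction is therefore written in a small
structured language, compiled to stack machines (`Run.evalsToInTime`) and run in front of the
assumed solver (`followedBy_outputsInTime`). To list a row's partial assignments in order, the
program treats the assigned variables as the digits of a binary counter (`next`). -/

open Function Turing StateTransition

/-! ### Structured stack programs -/

/-- Structured programs over stacks of bits indexed by `K`. `pop k P` pops the stack `k` and goes on
with the branch for the symbol found; `loop k c P` pops `k`, and if the symbol found passes the
test `c` it executes the branch for it and starts over. -/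
inductive StackProg (K : Type) : Type
  | skip : StackProg K
  | push (k : K) (b : Bool) : StackProg K
  | seq (P Q : StackProg K) : StackProg K
  | pop (k : K) (P : Option Bool → StackProg K) : StackProg K
  | loop (k : K) (c : Option Bool → Bool) (P : Option Bool → StackProg K) : StackProg K

namespace StackProg

/-- Sequential composition of programs. -/
infixr:65 " ;; " => StackProg.seq

variable {K : Type} [DecidableEq K]

/-- `Run P S t S'`: started with the stacks `S`, the program `P` ends with the stacks `S'` after at
most `t` steps. -/
inductive Run : StackProg K → (K → List Bool) → ℕ → (K → List Bool) → Prop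
  | skip (S) : Run skip S 0 S
  | push (S k b) : Run (push k b) S 1 (update S k (b :: S k))
  | seq {P Q S S₁ S₂ t₁ t₂} : Run P S t₁ S₁ → Run Q S₁ t₂ S₂ → Run (P ;; Q) S (t₁ + t₂) S₂
  | pop {k P S S' t} : Run (P (S k).head?) (update S k (S k).tail) t S' →
      Run (pop k P) S (t + 1) S'
  | loop_exit {k c P S} : c (S k).head? = false → Run (loop k c P) S 1 (update S k (S k).tail)
  | loop_next {k c P S S₁ S₂ t₁ t₂} : c (S k).head? = true →
      Run (P (S k).head?) (update S k (S k).tail) t₁ S₁ → Run (loop k c P) S₁ t₂ S₂ →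
      Run (loop k c P) S (t₁ + t₂ + 1) S₂
  | mono {P S S' t t'} : Run P S t S' → t ≤ t' → Run P S t' S'

/-- The labels that occur in a program. -/
def Label : StackProg K → Type
  | skip => Empty
  | push _ _ => Unit
  | seq P Q => P.Label ⊕ Q.Label
  | pop _ P => Option (Σ o, (P o).Label)
  | loop _ _ P => Option (Σ o, (P o).Label)

/-- There are finitely many labels. -/
@[reducible] def labelFintype : (P : StackProg K) → Fintype P.Label
  | skip => inferInstanceAs (Fintype Empty)
  | push _ _ => inferInstanceAs (Fintype Unit)
  | seq P Q =>
    letI := P.labelFintype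
    letI := Q.labelFintype
    inferInstanceAs (Fintype (P.Label ⊕ Q.Label))
  | pop _ P =>
    letI := fun o => (P o).labelFintype
    inferInstanceAs (Fintype (Option (Σ o, (P o).Label)))
  | loop _ _ P =>
    letI := fun o => (P o).labelFintype
    inferInstanceAs (Fintype (Option (Σ o, (P o).Label)))

instance (P : StackProg K) : Fintype P.Label := P.labelFintype

/-- The label at which the execution of a program starts, if its labels are embedded by `e` and it
is left through the label `x`. -/
def entry {Λ : Type} : (P : StackProg K) → (P.Label → Λ) → Λ → Λ
  | skip, _, x => x
  | push _ _, e, _ => e ()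
  | seq P Q, e, x => P.entry (fun l => e (Sum.inl l)) (Q.entry (fun l => e (Sum.inr l)) x)
  | pop _ _, e, _ => e none
  | loop _ _ _, e, _ => e none

/-! ### Compilation of programs to machine instructions -/

section Compile

variable {K₂ : Type} [DecidableEq K₂] {Γ₂ : K₂ → Type} {Λ σ₂ : Type}

/-- The stack alphabets of a machine that has the stacks of bits of a program and further stacks. -/
abbrev Alphabet (K : Type) {K₂ : Type} (Γ₂ : K₂ → Type) : K ⊕ K₂ → Type :=
  Sum.elim (fun _ => Bool) Γ₂

/-- The contents of the stacks of bits together with the contents of the further stacks. -/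
def joinStacks (S : K → List Bool) (T : ∀ k, List (Γ₂ k)) : ∀ k, List (Alphabet K Γ₂ k)
  | Sum.inl k => S k
  | Sum.inr k => T k

theorem update_joinStacks_inl (S : K → List Bool) (T : ∀ k, List (Γ₂ k)) (k : K) (l : List Bool) :
    update (joinStacks S T) (Sum.inl k) l = joinStacks (update S k l) T := by
  funext k'
  rcases k' with k' | k'
  · by_cases h : k' = k
    · subst h
      exact (update_self ..).trans (update_self k' l S).symm
    · exact (update_of_ne (by simpa using h) _ _).trans
        (show S k' = update S k l k' from (update_of_ne h l S).symm)
  · exact update_of_ne (by simp) _ _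

theorem update_joinStacks_inr (S : K → List Bool) (T : ∀ k, List (Γ₂ k)) (k : K₂)
    (l : List (Γ₂ k)) :
    update (joinStacks S T) (Sum.inr k) l = joinStacks S (update T k l) := by
  funext k'
  rcases k' with k' | k'
  · exact update_of_ne (by simp) _ _
  · by_cases h : k' = k
    · subst h
      exact (update_self ..).trans (update_self k' l T).symm
    · exact (update_of_ne (by simpa using h) _ _).trans
        (show T k' = update T k l k' from (update_of_ne h l T).symm)

theorem stepAux_push_inl (S : K → List Bool) (T : ∀ k, List (Γ₂ k)) (k : K)
    (f : σ₂ → Bool) (q : TM2.Stmt (Alphabet K Γ₂) Λ σ₂) (v : σ₂) :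
    TM2.stepAux (.push (Sum.inl k) f q) v (joinStacks S T) =
      TM2.stepAux q v (joinStacks (update S k (f v :: S k)) T) :=
  congrArg (TM2.stepAux q v) (update_joinStacks_inl S T k _)

theorem stepAux_pop_inl (S : K → List Bool) (T : ∀ k, List (Γ₂ k)) (k : K)
    (f : σ₂ → Option Bool → σ₂) (q : TM2.Stmt (Alphabet K Γ₂) Λ σ₂) (v : σ₂) :
    TM2.stepAux (.pop (Sum.inl k) f q) v (joinStacks S T) =
      TM2.stepAux q (f v (S k).head?) (joinStacks (update S k (S k).tail) T) :=
  congrArg (TM2.stepAux q _) (update_joinStacks_inl S T k _)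

theorem stepAux_push_inr (S : K → List Bool) (T : ∀ k, List (Γ₂ k)) (k : K₂)
    (f : σ₂ → Γ₂ k) (q : TM2.Stmt (Alphabet K Γ₂) Λ σ₂) (v : σ₂) :
    TM2.stepAux (.push (Sum.inr k) f q) v (joinStacks S T) =
      TM2.stepAux q v (joinStacks S (update T k (f v :: T k))) :=
  congrArg (TM2.stepAux q v) (update_joinStacks_inr S T k _)

theorem stepAux_pop_inr (S : K → List Bool) (T : ∀ k, List (Γ₂ k)) (k : K₂)
    (f : σ₂ → Option (Γ₂ k) → σ₂) (q : TM2.Stmt (Alphabet K Γ₂) Λ σ₂) (v : σ₂) :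
    TM2.stepAux (.pop (Sum.inr k) f q) v (joinStacks S T) =
      TM2.stepAux q (f v (T k).head?) (joinStacks S (update T k (T k).tail)) :=
  congrArg (TM2.stepAux q _) (update_joinStacks_inr S T k _)

/-- One step of a machine at a known label. -/
theorem evalsToInTime_one {Γ : K₂ → Type} {m : Λ → TM2.Stmt Γ Λ σ₂} {l : Λ}
    {q : TM2.Stmt Γ Λ σ₂} {v : σ₂} {S : ∀ k, List (Γ k)} {c : TM2.Cfg Γ Λ σ₂} (hq : m l = q)
    (h : TM2.stepAux q v S = c) :
    Nonempty (EvalsToInTime (TM2.step m) ⟨some l, v, S⟩ (some c) 1) :=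
  ⟨⟨⟨1, by subst hq h; rfl⟩, le_rfl⟩⟩

/-- The machine instructions of a program. -/
def code : (P : StackProg K) → (P.Label → Λ) → Λ → P.Label →
    TM2.Stmt (Alphabet K Γ₂) Λ (Option Bool × σ₂)
  | skip, _, _, l => nomatch (show Empty from l)
  | push k b, _, x, _ => .push (Sum.inl k) (fun _ => b) (.goto fun _ => x)
  | seq P Q, e, x, Sum.inl l =>
    P.code (fun l => e (Sum.inl l)) (Q.entry (fun l => e (Sum.inr l)) x) l
  | seq _ Q, e, x, Sum.inr l => Q.code (fun l => e (Sum.inr l)) x l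
  | pop k P, e, x, none => .pop (Sum.inl k) (fun s o => (o, s.2))
      (.goto fun s => (P s.1).entry (fun l => e (some ⟨s.1, l⟩)) x)
  | pop _ P, e, x, some ⟨o, l⟩ => (P o).code (fun l => e (some ⟨o, l⟩)) x l
  | loop k c P, e, x, none => .pop (Sum.inl k) (fun s o => (o, s.2))
      (.goto fun s => bif c s.1 then (P s.1).entry (fun l => e (some ⟨s.1, l⟩)) (e none) else x)
  | loop _ _ P, e, _, some ⟨o, l⟩ => (P o).code (fun l => e (some ⟨o, l⟩)) (e none) l

/-- The compiled program simulates the program step by step. -/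
theorem Run.evalsToInTime {P : StackProg K} {S S' : K → List Bool} {t : ℕ} (h : Run P S t S')
    (m : Λ → TM2.Stmt (Alphabet K Γ₂) Λ (Option Bool × σ₂)) (T : ∀ k, List (Γ₂ k)) (s : σ₂)
    (e : P.Label → Λ) (x : Λ) (hm : ∀ l, m (e l) = P.code e x l) (r : Option Bool) :
    ∃ r', Nonempty (EvalsToInTime (TM2.step m)
      ⟨some (P.entry e x), (r, s), joinStacks S T⟩
      (some ⟨some x, (r', s), joinStacks S' T⟩) t) := by
  -- The exit label must vary: the first half of a sequence exits to the entry of the second, and a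
  -- loop body exits to the loop's own label.
  induction h generalizing x r with
  | skip S => exact ⟨r, ⟨EvalsToInTime.refl _ _⟩⟩
  | push S k b => exact ⟨r, evalsToInTime_one (hm ()) (stepAux_push_inl S T k _ _ _)⟩
  | seq _ _ ih₁ ih₂ =>
    obtain ⟨r₁, ⟨h₁⟩⟩ := ih₁ (fun l => e (Sum.inl l)) _ (fun l => hm (Sum.inl l)) r
    obtain ⟨r₂, ⟨h₂⟩⟩ := ih₂ (fun l => e (Sum.inr l)) _ (fun l => hm (Sum.inr l)) r₁
    refine ⟨r₂, ⟨?_⟩⟩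
    rw [add_comm]
    exact EvalsToInTime.trans _ _ _ _ _ _ h₁ h₂
  | @pop k P S S' t _ ih =>
    obtain ⟨r₁, ⟨h₁⟩⟩ := ih (fun l => e (some ⟨_, l⟩)) x (fun l => hm (some ⟨_, l⟩)) (S k).head?
    obtain ⟨h₀⟩ := evalsToInTime_one (v := (r, s)) (S := joinStacks S T) (hm none)
      (stepAux_pop_inl S T k (fun s o => (o, s.2))
        (.goto fun s : Option Bool × σ₂ => (P s.1).entry (fun l => e (some ⟨s.1, l⟩)) x) (r, s))
    exact ⟨r₁, ⟨EvalsToInTime.trans _ _ _ _ _ _ h₀ h₁⟩⟩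
  | @loop_exit k c P S hc =>
    refine ⟨(S k).head?, evalsToInTime_one (hm none)
      ((stepAux_pop_inl S T k (fun s o => (o, s.2)) (.goto fun s : Option Bool × σ₂ =>
        bif c s.1 then (P s.1).entry (fun l => e (some ⟨s.1, l⟩)) (e none) else x) (r, s)).trans ?_)⟩
    simp only [TM2.stepAux, hc, cond_false]
  | @loop_next k c P S S₁ S₂ t₁ t₂ hc _ _ ih₁ ih₂ =>
    obtain ⟨r₁, ⟨h₁⟩⟩ := ih₁ (fun l => e (some ⟨_, l⟩)) (e none) (fun l => hm (some ⟨_, l⟩))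
      (S k).head?
    obtain ⟨r₂, ⟨h₂⟩⟩ := ih₂ e x hm r₁
    refine ⟨r₂, ?_⟩
    rw [add_comm t₁]
    have h₀ : Nonempty (EvalsToInTime (TM2.step m)
        ⟨some ((loop k c P).entry e x), (r, s), joinStacks S T⟩
        (some ⟨some ((P (S k).head?).entry (fun l => e (some ⟨(S k).head?, l⟩)) (e none)),
          ((S k).head?, s), joinStacks (update S k (S k).tail) T⟩) 1) :=
      evalsToInTime_one (hm none)
        ((stepAux_pop_inl S T k (fun s o => (o, s.2)) (.goto fun s : Option Bool × σ₂ =>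
          bif c s.1 then (P s.1).entry (fun l => e (some ⟨s.1, l⟩)) (e none) else x) (r, s)).trans
            (by simp only [TM2.stepAux, hc, cond_true]))
    obtain ⟨h₀⟩ := h₀
    exact ⟨EvalsToInTime.trans _ _ _ _ _ _ h₀ (EvalsToInTime.trans _ _ _ _ _ _ h₁ h₂)⟩
  | mono _ hle ih =>
    obtain ⟨r', ⟨h⟩⟩ := ih e x hm r
    exact ⟨r', ⟨⟨h.toEvalsTo, h.steps_le_m.trans hle⟩⟩⟩

end Compile

end StackProg

/-- Evaluation respects equality of its data. -/
theorem evalsToInTime_congr {σ : Type*} {f : σ → Option σ} {a a' : σ} {b b' : Option σ} {m m' : ℕ}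
    (h : Nonempty (EvalsToInTime f a b m)) (ha : a = a') (hb : b = b') (hm : m = m') :
    Nonempty (EvalsToInTime f a' b' m') := by
  subst ha hb hm
  exact h

namespace StackProg

variable {K : Type} [DecidableEq K]

/-! ### Running a program in front of a given machine -/

section Compose

variable (M : FinTM2)

/-- A statement of `M` as a statement of a machine that has further stacks and a further component
of its internal state. -/
def liftStmt {Λ₁ : Type} : TM2.Stmt M.Γ M.Λ M.σ →
    TM2.Stmt (Alphabet K M.Γ) (Λ₁ ⊕ M.Λ) (Option Bool × M.σ)
  | .push k f q => .push (Sum.inr k) (fun s => f s.2) (liftStmt q)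
  | .peek k f q => .peek (Sum.inr k) (fun s o => (s.1, f s.2 o)) (liftStmt q)
  | .pop k f q => .pop (Sum.inr k) (fun s o => (s.1, f s.2 o)) (liftStmt q)
  | .load f q => .load (fun s => (s.1, f s.2)) (liftStmt q)
  | .branch f q₁ q₂ => .branch (fun s => f s.2) (liftStmt q₁) (liftStmt q₂)
  | .goto f => .goto fun s => Sum.inr (f s.2)
  | .halt => .halt

/-- A configuration of `M` as a configuration of the larger machine. -/
def liftCfg {Λ₁ : Type} (r : Option Bool) (S : K → List Bool) (c : TM2.Cfg M.Γ M.Λ M.σ) :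
    TM2.Cfg (Alphabet K M.Γ) (Λ₁ ⊕ M.Λ) (Option Bool × M.σ) :=
  ⟨c.l.map Sum.inr, (r, c.var), joinStacks S c.stk⟩

/-- Lifted statements touch neither the bit stacks nor the register, so lifting commutes with
execution. -/
theorem stepAux_liftStmt {Λ₁ : Type} (r : Option Bool) (S : K → List Bool)
    (q : TM2.Stmt M.Γ M.Λ M.σ) (v : M.σ) (T : ∀ k, List (M.Γ k)) :
    TM2.stepAux (liftStmt (K := K) (Λ₁ := Λ₁) M q) (r, v) (joinStacks S T) =
      liftCfg M r S (TM2.stepAux q v T) := by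
  induction q generalizing v T with
  | push k f q ih =>
    exact (stepAux_push_inr S T k (fun s : Option Bool × M.σ => f s.2) _ (r, v)).trans (ih _ _)
  | peek k f q ih => exact ih _ _
  | pop k f q ih =>
    exact (stepAux_pop_inr S T k (fun (s : Option Bool × M.σ) o => (s.1, f s.2 o)) _ (r, v)).trans
      (ih _ _)
  | load f q ih => exact ih _ _
  | branch f q₁ q₂ ih₁ ih₂ =>
    simp only [liftStmt, TM2.stepAux]
    cases f v
    · exact ih₂ _ _
    · exact ih₁ _ _
  | goto f => rfl
  | halt => rfl

theorem iterate_step_liftCfg {Λ₁ : Type} (r : Option Bool) (S : K → List Bool)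
    {m : Λ₁ ⊕ M.Λ → TM2.Stmt (Alphabet K M.Γ) (Λ₁ ⊕ M.Λ) (Option Bool × M.σ)}
    (hm : ∀ l, m (Sum.inr l) = liftStmt M (M.m l)) (t : ℕ) (c : Option (TM2.Cfg M.Γ M.Λ M.σ)) :
    (flip bind (TM2.step m))^[t] (c.map (liftCfg M r S)) =
      ((flip bind (TM2.step M.m))^[t] c).map (liftCfg M r S) := by
  induction t generalizing c with
  | zero => rfl
  | succ t ih =>
    rw [iterate_succ_apply, iterate_succ_apply, ← ih]
    congr 1
    rcases c with _ | ⟨_ | l, v, T⟩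
    · rfl
    · rfl
    · show some (TM2.stepAux (m (Sum.inr l)) (r, v) (joinStacks S T)) = _
      rw [hm, stepAux_liftStmt]
      rfl

variable [Fintype K] (P : StackProg K) (inp out : K) (toInput : Bool → M.Γ M.k₀)

/-- The statement that moves a symbol of the stack `out` to the input stack of `M`, or starts `M` if
there is none. -/
def transferStmt : TM2.Stmt (Alphabet K M.Γ) (Option P.Label ⊕ M.Λ) (Option Bool × M.σ) :=
  .pop (Sum.inl out) (fun s o => (o, s.2))
    (.branch (fun s => s.1.isSome)
      (.push (Sum.inr M.k₀) (fun s => toInput (s.1.getD false)) (.goto fun _ => Sum.inl none))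
      (.goto fun _ => Sum.inr M.main))

/-- The machine that executes the program `P`, moves the contents of the stack `out` to the
input stack of `M`, and then behaves like `M`. -/
def followedBy : FinTM2 where
  K := K ⊕ M.K
  kFin := letI := M.kFin; inferInstance
  k₀ := Sum.inl inp
  k₁ := Sum.inr M.k₁
  Γ := Alphabet K M.Γ
  Λ := Option P.Label ⊕ M.Λ
  main := P.entry (fun l => Sum.inl (some l)) (Sum.inl none)
  ΛFin := letI := M.ΛFin; inferInstance
  σ := Option Bool × M.σ
  initialState := (none, M.initialState)
  σFin := letI := M.σFin; inferInstance
  Γk₀Fin := inferInstanceAs (Fintype Bool)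
  m
    | Sum.inl (some l) => P.code (fun l => Sum.inl (some l)) (Sum.inl none) l
    | Sum.inl none => transferStmt M P out toInput
    | Sum.inr l => liftStmt M (M.m l)

/-- Moving symbols one by one reverses them, which is why programs leave their output reversed. The
last pop finds nothing and resets the register to `none`. -/
theorem transfer_evalsToInTime (w : List Bool) (T : ∀ k, List (M.Γ k)) (s : M.σ) (r : Option Bool) :
    Nonempty (EvalsToInTime (TM2.step (followedBy M P inp out toInput).m)
      ⟨some (Sum.inl none), (r, s), joinStacks (update (fun _ => []) out w) T⟩
      (some ⟨some (Sum.inr M.main), (none, s), joinStacks (fun _ => [])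
        (update T M.k₀ ((w.map toInput).reverse ++ T M.k₀))⟩) (w.length + 1)) := by
  induction w generalizing T r with
  | nil =>
    refine evalsToInTime_one (m := (followedBy M P inp out toInput).m)
      (q := transferStmt M P out toInput) rfl
      ((stepAux_pop_inl _ T out _ _ (r, s)).trans ?_)
    simp [TM2.stepAux]
    rfl
  | cons b w ih =>
    obtain ⟨h⟩ := ih (update T M.k₀ (toInput b :: T M.k₀)) (some b)
    have h₀ : Nonempty (EvalsToInTime (TM2.step (followedBy M P inp out toInput).m)
      ⟨some (Sum.inl none), (r, s), joinStacks (update (fun _ => []) out (b :: w)) T⟩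
      (some ⟨some (Sum.inl none), (some b, s), joinStacks (update (fun _ => []) out w)
        (update T M.k₀ (toInput b :: T M.k₀))⟩) 1) := by
      refine evalsToInTime_one (m := (followedBy M P inp out toInput).m)
        (q := transferStmt M P out toInput) rfl
        ((stepAux_pop_inl _ T out _ _ (r, s)).trans ?_)
      rw [update_self, update_idem]
      exact stepAux_push_inr _ T M.k₀ (fun s : Option Bool × M.σ => toInput (s.1.getD false))
        (.goto fun _ => Sum.inl none) (some b, s)
    obtain ⟨h₀⟩ := h₀
    have := EvalsToInTime.trans _ _ _ _ _ _ h₀ h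
    rw [update_self, update_idem] at this
    simpa using ⟨this⟩

theorem initList_stk (w : List (M.Γ M.k₀)) :
    (initList M w).stk = update (fun _ => []) M.k₀ w := by
  funext k
  by_cases h : k = M.k₀
  · subst h
    rw [update_self]
    exact dif_pos rfl
  · rw [update_of_ne h]
    exact dif_neg h

theorem haltList_stk (w : List (M.Γ M.k₁)) :
    (haltList M w).stk = update (fun _ => []) M.k₁ w := by
  funext k
  by_cases h : k = M.k₁
  · subst h
    rw [update_self]
    exact dif_pos rfl
  · rw [update_of_ne h]
    exact dif_neg h

/-- The bounds of the three phases add up: program, transfer, `M`. A halting configuration has the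
initial internal state and only the output stack filled, so the program must empty all its stacks
except `out`. -/
theorem followedBy_outputsInTime {w v : List Bool} {t₁ t₂ : ℕ} {o : List (M.Γ M.k₁)}
    (hP : Run P (update (fun _ => []) inp w) t₁ (update (fun _ => []) out v.reverse))
    (hM : Nonempty (TM2OutputsInTime M (v.map toInput) (some o) t₂)) :
    Nonempty (TM2OutputsInTime (followedBy M P inp out toInput) w (some o)
      (t₂ + ((v.length + 1) + t₁))) := by
  obtain ⟨hM⟩ := hM
  obtain ⟨r, ⟨h₁⟩⟩ := hP.evalsToInTime (followedBy M P inp out toInput).m (fun _ => [])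
    M.initialState (fun l => Sum.inl (some l)) (Sum.inl none) (fun _ => rfl) none
  have h₃ : EvalsToInTime (TM2.step (followedBy M P inp out toInput).m)
      (liftCfg M none (fun _ => []) (initList M (v.map toInput)))
      (some (liftCfg M none (fun _ => []) (haltList M o))) t₂ := by
    refine ⟨⟨hM.steps, ?_⟩, hM.steps_le_m⟩
    have := iterate_step_liftCfg M (none : Option Bool) (fun _ : K => [])
      (m := (followedBy M P inp out toInput).m) (fun _ => rfl) hM.steps
      (some (initList M (v.map toInput)))
    refine this.trans ?_
    have h := hM.evals_in_steps
    exact congrArg _ h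
  have e : (fun _ => [] : ∀ k, List (Alphabet K M.Γ k)) = joinStacks (fun _ => []) (fun _ => []) := by
    funext k
    rcases k with k | k <;> rfl
  have e₁ : initList (followedBy M P inp out toInput) w =
      ⟨some (P.entry (fun l => Sum.inl (some l)) (Sum.inl none)), (none, M.initialState),
        joinStacks (update (fun _ => []) inp w) (fun _ => [])⟩ := by
    refine congrArg (TM2.Cfg.mk _ _) ((initList_stk (followedBy M P inp out toInput) w).trans ?_)
    rw [← update_joinStacks_inl, ← e]
    rfl
  have e₂ : haltList (followedBy M P inp out toInput) o =
      liftCfg M none (fun _ => []) (haltList M o) := by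
    refine congrArg (TM2.Cfg.mk _ _) ((haltList_stk (followedBy M P inp out toInput) o).trans ?_)
    rw [haltList_stk, ← update_joinStacks_inr, ← e]
    rfl
  have e₃ : (⟨some (Sum.inr M.main), (none, M.initialState), joinStacks (fun _ => [])
        (update (fun _ => []) M.k₀ ((v.reverse.map toInput).reverse ++ []))⟩ :
        TM2.Cfg (Alphabet K M.Γ) (Option P.Label ⊕ M.Λ) (Option Bool × M.σ)) =
      liftCfg M none (fun _ => []) (initList M (v.map toInput)) := by
    refine congrArg (TM2.Cfg.mk _ _) ?_
    rw [initList_stk]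
    simp
  obtain ⟨h₂⟩ := evalsToInTime_congr (transfer_evalsToInTime M P inp out toInput v.reverse
    (fun _ => []) M.initialState r) rfl (congrArg some e₃) (congrArg (· + 1) v.length_reverse)
  exact evalsToInTime_congr
    ⟨EvalsToInTime.trans _ _ _ _ _ _ (EvalsToInTime.trans _ _ _ _ _ _ h₁ h₂) h₃⟩
    e₁.symm (congrArg some e₂.symm) rfl

end Compose

end StackProg

open StackProg in
/-- A reduction that is computed by a stack program turns an algorithm for the problem `Q` into an
algorithm for the problem `P`. -/
theorem SolvableInTime.of_reduction {α β : Type} {encA : α → List Bool} {encB : β → List Bool}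
    {P : α → Prop} {Q : β → Prop} {T : β → ℝ} (hQ : SolvableInTime encB Q T) (f : α → β)
    (hf : ∀ a, Q (f a) ↔ P a) {K : Type} [DecidableEq K] [Fintype K] (R : StackProg K)
    (inp out : K) (t : α → ℕ)
    (hR : ∀ a, Run R (update (fun _ => []) inp (encA a)) (t a)
      (update (fun _ => []) out (encB (f a)).reverse)) :
    SolvableInTime encA P fun a => T (f a) + ((encB (f a)).length + 1 + t a : ℕ) := by
  obtain ⟨M, hM⟩ := hQ
  refine ⟨⟨followedBy M.tm R inp out M.inputAlphabet.invFun, Equiv.refl Bool, M.outputAlphabet⟩,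
    fun a => ?_⟩
  obtain ⟨ans, s, hans, hs, hout⟩ := hM (f a)
  refine ⟨ans, s + ((encB (f a)).length + 1 + t a), hans.trans (hf a), ?_,
    followedBy_outputsInTime M.tm R inp out M.inputAlphabet.invFun (w := List.map id (encA a))
      (o := List.map _ _) ?_ hout⟩
  · push_cast
    linarith
  · rw [List.map_id]
    exact hR a

theorem SolvableInTime.mono {α Γ : Type} {enc : α → List Γ} {P : α → Prop} {T T' : α → ℝ}
    (h : SolvableInTime enc P T) (hT : ∀ a, T a ≤ T' a) : SolvableInTime enc P T' := by
  obtain ⟨M, hM⟩ := h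
  refine ⟨M, fun a => ?_⟩
  obtain ⟨ans, t, h₁, h₂, h₃⟩ := hM a
  exact ⟨ans, t, h₁, h₂.trans (hT a), h₃⟩

/-! ### The stacks of the reduction -/

/-- The stacks of the program that computes the reduction. -/
inductive Stk : Type
  | inp | inpDone | ctr | ctrDone | num | numDone | asg | asgDone | res | out
  deriving DecidableEq

instance : Fintype Stk where
  elems := {.inp, .inpDone, .ctr, .ctrDone, .num, .numDone, .asg, .asgDone, .res, .out}
  complete k := by cases k <;> decide

/-- The contents of the stacks. -/
structure Store : Type where
  inp : List Bool
  inpDone : List Bool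
  ctr : List Bool
  ctrDone : List Bool
  num : List Bool
  numDone : List Bool
  asg : List Bool
  asgDone : List Bool
  res : List Bool
  out : List Bool

namespace Store

/-- The contents of a stack. -/
def get (s : Store) : Stk → List Bool
  | .inp => s.inp
  | .inpDone => s.inpDone
  | .ctr => s.ctr
  | .ctrDone => s.ctrDone
  | .num => s.num
  | .numDone => s.numDone
  | .asg => s.asg
  | .asgDone => s.asgDone
  | .res => s.res
  | .out => s.out

/-- Replaces the contents of a stack. -/
def set (s : Store) (k : Stk) (l : List Bool) : Store :=
  match k with
  | .inp => { s with inp := l }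
  | .inpDone => { s with inpDone := l }
  | .ctr => { s with ctr := l }
  | .ctrDone => { s with ctrDone := l }
  | .num => { s with num := l }
  | .numDone => { s with numDone := l }
  | .asg => { s with asg := l }
  | .asgDone => { s with asgDone := l }
  | .res => { s with res := l }
  | .out => { s with out := l }

theorem update_get (s : Store) (k : Stk) (l : List Bool) :
    update s.get k l = (s.set k l).get := by
  funext k'
  cases k <;> cases k' <;> rfl

theorem get_set_self (s : Store) (k : Stk) (l : List Bool) : (s.set k l).get k = l := by
  rw [← update_get, update_self]

theorem get_set_of_ne (s : Store) {k k' : Stk} (l : List Bool) (h : k' ≠ k) :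
    (s.set k l).get k' = s.get k' := by
  rw [← update_get, update_of_ne h]

theorem get_injective : Injective get := by
  intro s s' h
  cases s
  cases s'
  rw [mk.injEq]
  exact ⟨congrFun h .inp, congrFun h .inpDone, congrFun h .ctr, congrFun h .ctrDone,
    congrFun h .num, congrFun h .numDone, congrFun h .asg, congrFun h .asgDone, congrFun h .res,
    congrFun h .out⟩

end Store

open StackProg

/-- `Exec P s t s'`: started with the store `s`, the program `P` ends with the store `s'` after at
most `t` steps. -/
def Exec (P : StackProg Stk) (s : Store) (t : ℕ) (s' : Store) : Prop :=
  Run P s.get t s'.get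

/-! ### Execution rules for stores -/

namespace Exec

variable {P Q : StackProg Stk} {R : Option Bool → StackProg Stk} {c : Option Bool → Bool} {k : Stk}
  {s s₁ s₂ : Store} {t t₁ t₂ : ℕ}

theorem skip (s : Store) : Exec skip s 0 s := Run.skip _

theorem push (s : Store) (k : Stk) (b : Bool) : Exec (push k b) s 1 (s.set k (b :: s.get k)) := by
  unfold Exec
  rw [← Store.update_get]
  exact Run.push _ _ _

theorem seq (h₁ : Exec P s t₁ s₁) (h₂ : Exec Q s₁ t₂ s₂) : Exec (P ;; Q) s (t₁ + t₂) s₂ :=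
  Run.seq h₁ h₂

theorem pop (h : Exec (R (s.get k).head?) (s.set k (s.get k).tail) t s₁) :
    Exec (pop k R) s (t + 1) s₁ := by
  unfold Exec at h
  rw [← Store.update_get] at h
  exact Run.pop h

theorem loop_exit (h : c (s.get k).head? = false) :
    Exec (loop k c R) s 1 (s.set k (s.get k).tail) := by
  unfold Exec
  rw [← Store.update_get]
  exact Run.loop_exit h

theorem loop_next (h : c (s.get k).head? = true)
    (h₁ : Exec (R (s.get k).head?) (s.set k (s.get k).tail) t₁ s₁)
    (h₂ : Exec (loop k c R) s₁ t₂ s₂) : Exec (loop k c R) s (t₁ + t₂ + 1) s₂ := by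
  unfold Exec at h₁
  rw [← Store.update_get] at h₁
  exact Run.loop_next h h₁ h₂

/-- Lets unification compute the final store and the time first; both are compared with the claimed
ones afterwards. -/
theorem cast (h : Exec P s t s₁) (hs : s₁ = s₂) (ht : t ≤ t₂) : Exec P s t₂ s₂ := by
  subst hs
  exact Run.mono h ht

end Exec

namespace GridReduction

/-! ### Elementary programs -/

/-- Pushes a symbol if there is one. -/
def pushOpt (k : Stk) (o : Option Bool) : StackProg Stk :=
  o.elim skip (push k)

/-- Moves the contents of the stack `a` to the stack `b`. -/
def moveAll (a b : Stk) : StackProg Stk :=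
  loop a Option.isSome (pushOpt b)

/-- Two steps per symbol and one for the failing test. The order is reversed, so moving away and
back restores a stack. -/
theorem moveAll_exec {a b : Stk} (hab : a ≠ b) (s : Store) :
    Exec (moveAll a b) s (2 * (s.get a).length + 1)
      ((s.set a []).set b ((s.get a).reverse ++ s.get b)) := by
  obtain ⟨l, hl⟩ : ∃ l, s.get a = l := ⟨_, rfl⟩
  induction l generalizing s with
  | nil =>
    refine (Exec.loop_exit (by rw [hl]; rfl)).cast (Store.get_injective ?_) (by omega)
    rw [← Store.update_get, ← Store.update_get, ← Store.update_get, hl]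
    funext k
    by_cases h : k = b
    · subst h
      rw [update_self, update_of_ne hab.symm]
      rfl
    · rw [update_of_ne h]
      rfl
  | cons x l ih =>
    have h₁ : Exec (pushOpt b (s.get a).head?) (s.set a (s.get a).tail) 1
        ((s.set a l).set b (x :: s.get b)) := by
      rw [hl]
      refine (Exec.push _ _ _).cast ?_ le_rfl
      rw [Store.get_set_of_ne _ _ hab.symm]
      rfl
    have h₂ := ih ((s.set a l).set b (x :: s.get b))
      (by rw [Store.get_set_of_ne _ _ hab, Store.get_set_self])
    rw [Store.get_set_of_ne _ _ hab, Store.get_set_self, Store.get_set_self] at h₂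
    refine (Exec.loop_next (by rw [hl]; rfl) h₁ h₂).cast (Store.get_injective ?_) ?_
    · simp only [← Store.update_get, hl]
      funext k
      by_cases h : k = b
      · subst h
        simp
      · by_cases h' : k = a
        · subst h'
          simp [h]
        · simp [h, h']
    · rw [hl, List.length_cons]
      omega

/-- Empties the stack `a`. -/
def clear (a : Stk) : StackProg Stk :=
  loop a Option.isSome fun _ => skip

theorem clear_exec (a : Stk) (s : Store) :
    Exec (clear a) s ((s.get a).length + 1) (s.set a []) := by
  obtain ⟨l, hl⟩ : ∃ l, s.get a = l := ⟨_, rfl⟩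
  induction l generalizing s with
  | nil =>
    refine (Exec.loop_exit (by rw [hl]; rfl)).cast ?_ (by omega)
    rw [hl]
    rfl
  | cons x l ih =>
    have h₂ := ih (s.set a l) (Store.get_set_self ..)
    rw [Store.get_set_self] at h₂
    refine (Exec.loop_next (by rw [hl]; rfl) (Exec.skip _) (by rw [hl]; exact h₂)).cast
      (Store.get_injective ?_) (by rw [hl, List.length_cons]; omega)
    simp only [← Store.update_get, update_idem]

/-- Pushes the symbols of a list, one after the other. -/
def pushList (k : Stk) (l : List Bool) : StackProg Stk :=
  l.foldr (fun b P => push k b ;; P) skip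

theorem pushList_exec (k : Stk) (l : List Bool) (s : Store) :
    Exec (pushList k l) s l.length (s.set k (l.reverse ++ s.get k)) := by
  induction l generalizing s with
  | nil =>
    refine (Exec.skip _).cast (Store.get_injective ?_) le_rfl
    rw [← Store.update_get]
    exact (update_eq_self k s.get).symm
  | cons b l ih =>
    refine (Exec.seq (Exec.push s k b) (ih _)).cast (Store.get_injective ?_) (by simp; omega)
    simp only [← Store.update_get, update_idem, update_self]
    simp

theorem replicate_append_cons (n : ℕ) (b : Bool) (l : List Bool) :
    List.replicate n b ++ b :: l = b :: (List.replicate n b ++ l) := by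
  induction n with
  | zero => rfl
  | succ n ih => rw [List.replicate_succ, List.cons_append, ih]; rfl

/-! ### Partial assignments -/

/-- A partial assignment: each variable comes with the information whether it may be true and
whether it may be false. -/
abbrev PartialAssignment : Type := List (Bool × Bool)

/-- The contents of a stack that holds a partial assignment. -/
def flat : PartialAssignment → List Bool
  | [] => []
  | e :: w => e.1 :: e.2 :: flat w

theorem flat_length (w : PartialAssignment) : (flat w).length = 2 * w.length := by
  induction w with
  | nil => rfl
  | cons e w ih => simp only [flat, List.length_cons, ih]; omega

theorem flat_append (w₁ w₂ : PartialAssignment) : flat (w₁ ++ w₂) = flat w₁ ++ flat w₂ := by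
  induction w₁ with
  | nil => rfl
  | cons e w ih => simp [flat, ih]

/-- Whether a variable may have the value `b`. -/
def allows (e : Bool × Bool) (b : Bool) : Bool := bif b then e.1 else e.2

/-- Whether the variable `j` may have the value `b`. -/
def test (w : PartialAssignment) (j : ℕ) (b : Bool) : Bool := allows (w.getD j (true, true)) b

theorem exists_eq_append_cons {w : PartialAssignment} {j : ℕ} (hj : j < w.length) :
    ∃ w₁ e w₂, w = w₁ ++ e :: w₂ ∧ w₁.length = j ∧ ∀ b, test w j b = allows e b := by
  refine ⟨w.take j, w[j], w.drop (j + 1), ?_, by simp; omega, fun b => ?_⟩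
  · rw [List.getElem_cons_drop, List.take_append_drop]
  · rw [test, List.getD_eq_getElem _ _ hj]

/-- The next partial assignment: the variables with a unique value are the digits of a binary
number, which is incremented. -/
def next : PartialAssignment → PartialAssignment
  | [] => []
  | (true, true) :: w => (true, true) :: next w
  | (true, false) :: w => (false, true) :: next w
  | (false, _) :: w => (true, false) :: w

theorem next_length (w : PartialAssignment) : (next w).length = w.length := by
  induction w with
  | nil => rfl
  | cons e w ih =>
    rcases e with ⟨_ | _, _ | _⟩ <;> simp [next, ih]

/-- Passes to the literal at the top of the input and to the entry of its variable. -/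
def seek : StackProg Stk :=
  loop .inp (· == some true) (fun _ => push .inpDone true ;;
    pop .asg fun p => pushOpt .asgDone p ;; pop .asg fun q => pushOpt .asgDone q) ;;
  push .inpDone false

/-- The unary index is read in lockstep with the assignment: each `true` carries one entry, that is
two bits, to `asgDone`. The loop swallows the delimiter on exit, so it is pushed again on `inpDone`.
-/
theorem seek_exec (w₁ w₂ : PartialAssignment) (i c a a' n n' v r o : List Bool) :
    Exec seek ⟨List.replicate w₁.length true ++ false :: i, c, a, a', n, n', flat (w₁ ++ w₂), v, r, o⟩
      (6 * w₁.length + 2)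
      ⟨i, false :: (List.replicate w₁.length true ++ c), a, a', n, n', flat w₂,
        (flat w₁).reverse ++ v, r, o⟩ := by
  suffices h : ∀ c v, Exec (loop .inp (· == some true) (fun _ => push .inpDone true ;;
      pop .asg fun p => pushOpt .asgDone p ;; pop .asg fun q => pushOpt .asgDone q))
      ⟨List.replicate w₁.length true ++ false :: i, c, a, a', n, n', flat (w₁ ++ w₂), v, r, o⟩
      (6 * w₁.length + 1)
      ⟨i, List.replicate w₁.length true ++ c, a, a', n, n', flat w₂, (flat w₁).reverse ++ v, r, o⟩
    from (h c v).seq (.push _ _ _)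
  induction w₁ with
  | nil => exact fun c v => .loop_exit rfl
  | cons e w₁ ih =>
    intro c v
    refine (Exec.loop_next rfl (.seq (.push _ _ _) (.pop (.seq (.push _ _ _) (.pop (.push _ _ _)))))
      (ih (true :: c) (e.2 :: e.1 :: v))).cast ?_ ?_
    · simp [replicate_append_cons, flat, List.replicate_succ]
    · rw [List.length_cons]
      omega

/-- Reads whether the present variable may have the value `b`. -/
def readEntry (b : Bool) (k : Stk) : StackProg Stk :=
  pop .asg fun p => pushOpt .asgDone p ;; pop .asg fun q => pushOpt .asgDone q ;;
    push k (allows (p.getD false, q.getD false) b)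

/-- Evaluates the literal at the top of the input. -/
def readLiteral : StackProg Stk :=
  seek ;; pop .inp (fun b => pushOpt .inpDone b ;; readEntry (b.getD false) .res) ;;
    moveAll .asgDone .asg

theorem readLiteral_exec {w : PartialAssignment} {j : ℕ} (hj : j < w.length) (b : Bool)
    (i c a a' n n' r o : List Bool) :
    Exec readLiteral ⟨List.replicate j true ++ false :: b :: i, c, a, a', n, n', flat w, [], r, o⟩
      (10 * j + 14)
      ⟨i, b :: false :: (List.replicate j true ++ c), a, a', n, n', flat w, [],
        test w j b :: r, o⟩ := by
  obtain ⟨w₁, e, w₂, rfl, rfl, he⟩ := exists_eq_append_cons hj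
  rw [he]
  refine (Exec.seq (seek_exec w₁ (e :: w₂) _ _ _ _ _ _ _ _ _) (.seq (.pop (.seq (.push _ _ _)
    (.pop (.seq (.push _ _ _) (.pop (.seq (.push _ _ _) (.push _ _ _)))))))
    (moveAll_exec (by decide) _))).cast ?_ ?_
  · simp [Store.set, Store.get, flat_append, flat]
  · simp [Store.set, Store.get, flat_length]
    omega

/-- Outputs whether the variable whose index is at the top of the input may have the value `b`. -/
def outputEntry (b : Bool) : StackProg Stk :=
  seek ;; readEntry b .out ;; moveAll .asgDone .asg ;; moveAll .inpDone .inp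

theorem outputEntry_exec {w : PartialAssignment} {j : ℕ} (hj : j < w.length) (b : Bool)
    (i a a' n n' r o : List Bool) :
    Exec (outputEntry b) ⟨List.replicate j true ++ false :: i, [], a, a', n, n', flat w, [], r, o⟩
      (12 * j + 15)
      ⟨List.replicate j true ++ false :: i, [], a, a', n, n', flat w, [], r, test w j b :: o⟩ := by
  obtain ⟨w₁, e, w₂, rfl, rfl, he⟩ := exists_eq_append_cons hj
  rw [he]
  refine (Exec.seq (seek_exec w₁ (e :: w₂) _ _ _ _ _ _ _ _ _) (.seq
    (.pop (.seq (.push _ _ _) (.pop (.seq (.push _ _ _) (.push _ _ _)))))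
    (.seq (moveAll_exec (by decide) _) (moveAll_exec (by decide) _)))).cast ?_ ?_
  · simp [Store.set, Store.get, flat_append, flat]
  · simp [Store.set, Store.get, flat_length]
    omega

/-- Replaces the partial assignment by the next one. -/
def incr : StackProg Stk :=
  loop .asg (· == some true) (fun _ => pop .asg fun q =>
    bif q.getD false then push .asgDone true ;; push .asgDone true
    else push .asgDone false ;; push .asgDone true) ;;
  pop .asg (fun o => o.elim skip fun _ => push .asgDone true ;; push .asgDone false) ;;
  moveAll .asgDone .asg

theorem incr_exec (w : PartialAssignment) (i c a a' n n' r o : List Bool) :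
    Exec incr ⟨i, c, a, a', n, n', flat w, [], r, o⟩ (8 * w.length + 10)
      ⟨i, c, a, a', n, n', flat (next w), [], r, o⟩ := by
  -- `x` holds the entries already processed, reversed, and `y` the untouched rest. The loop carries
  -- past free variables and digits `true`; it stops after popping half of the first digit `false`,
  -- or at the bottom, where the counter has overflowed to zero.
  suffices h : ∀ v, ∃ x y s, x.reverse ++ y = flat (next w) ∧
      Exec (loop .asg (· == some true) (fun _ => pop .asg fun q =>
          bif q.getD false then push .asgDone true ;; push .asgDone true
          else push .asgDone false ;; push .asgDone true))
        ⟨i, c, a, a', n, n', flat w, v, r, o⟩ (4 * w.length + 1) s ∧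
      Exec (pop .asg (fun o => o.elim skip fun _ => push .asgDone true ;; push .asgDone false)) s 3
        ⟨i, c, a, a', n, n', y, x ++ v, r, o⟩ by
    obtain ⟨x, y, s, hxy, h₁, h₂⟩ := h []
    refine (Exec.seq h₁ (.seq h₂ (moveAll_exec (by decide) _))).cast ?_ ?_
    · simp [Store.set, Store.get, hxy]
    · have := congrArg List.length hxy
      simp [flat_length, next_length] at this
      simp [Store.get]
      omega
  induction w with
  | nil =>
    intro v
    exact ⟨[], [], _, rfl, .loop_exit rfl, .cast (.pop (.skip _)) rfl (by omega)⟩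
  | cons e w ih =>
    intro v
    rcases e with ⟨_ | _, q⟩
    · exact ⟨[false, true], flat w, _, by simp [next, flat], .cast (.loop_exit rfl) rfl (by simp),
        .pop (.seq (.push _ _ _) (.push _ _ _))⟩
    · cases q
      · obtain ⟨x, y, s, hxy, h₁, h₂⟩ := ih (true :: false :: v)
        refine ⟨x ++ [true, false], y, s, by simp [next, flat, hxy], ?_, by simpa using h₂⟩
        refine (Exec.loop_next rfl (.pop (.seq (.push _ _ _) (.push _ _ _))) h₁).cast rfl ?_
        rw [List.length_cons]
        omega
      · obtain ⟨x, y, s, hxy, h₁, h₂⟩ := ih (true :: true :: v)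
        refine ⟨x ++ [true, true], y, s, by simp [next, flat, hxy], ?_, by simpa using h₂⟩
        refine (Exec.loop_next rfl (.pop (.seq (.push _ _ _) (.push _ _ _))) h₁).cast rfl ?_
        rw [List.length_cons]
        omega

/-! ### Evaluation of the formula -/

/-- Whether every clause has a literal that the partial assignment `w` allows. -/
def passes {n : ℕ} (w : PartialAssignment) (cs : List (Fin 3 → Literal n)) : Bool :=
  cs.all fun c => test w (c 0).1 (c 0).2 || test w (c 1).1 (c 1).2 || test w (c 2).1 (c 2).2

/-- The encoding of a list of clauses. -/
def encodeClauses {n : ℕ} (cs : List (Fin 3 → Literal n)) : List Bool :=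
  cs.flatMap fun c => (List.finRange 3).flatMap fun k => ThreeCNF.encodeLiteral (c k)

theorem encodeClauses_cons {n : ℕ} (c : Fin 3 → Literal n) (cs : List (Fin 3 → Literal n)) :
    encodeClauses (c :: cs) =
      List.replicate (c 0).1 true ++ false :: (c 0).2 ::
        (List.replicate (c 1).1 true ++ false :: (c 1).2 ::
          (List.replicate (c 2).1 true ++ false :: (c 2).2 :: encodeClauses cs)) := by
  simp [encodeClauses, List.finRange_succ, ThreeCNF.encodeLiteral]

theorem encodeClauses_length_le {n : ℕ} (cs : List (Fin 3 → Literal n)) :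
    (encodeClauses cs).length ≤ cs.length * (3 * n + 3) := by
  induction cs with
  | nil => simp [encodeClauses]
  | cons c cs ih =>
    have h₀ := (c 0).1.isLt
    have h₁ := (c 1).1.isLt
    have h₂ := (c 2).1.isLt
    rw [encodeClauses_cons]
    simp only [List.length_append, List.length_replicate, List.length_cons, add_mul, one_mul]
    omega

/-- Combines the values of three literals with the value of the clauses before. -/
def combine : StackProg Stk :=
  pop .res fun z => pop .res fun y => pop .res fun x => pop .res fun g =>
    push .res (g.getD false && (x.getD false || y.getD false || z.getD false))

/-- Evaluates the clause at the top of the input. -/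
def readClause : StackProg Stk :=
  readLiteral ;; readLiteral ;; readLiteral ;; combine

/-- Evaluates the formula and outputs the value. -/
def outputValue : StackProg Stk :=
  push .res true ;; loop .inp Option.isSome (fun o => pushOpt .inp o ;; readClause) ;;
    moveAll .inpDone .inp ;; pop .res (pushOpt .out)

/-- The top of `res` accumulates the value `g` of the clauses read so far. The loop test consumes a
symbol of the clause, which the body pushes back. -/
theorem readClauses_exec {n : ℕ} {w : PartialAssignment} (hw : w.length = n)
    (cs : List (Fin 3 → Literal n)) (c a a' m m' r o : List Bool) (g : Bool) :
    Exec (loop .inp Option.isSome (fun o => pushOpt .inp o ;; readClause))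
      ⟨encodeClauses cs, c, a, a', m, m', flat w, [], g :: r, o⟩ (cs.length * (30 * n + 50) + 1)
      ⟨[], (encodeClauses cs).reverse ++ c, a, a', m, m', flat w, [], (g && passes w cs) :: r,
        o⟩ := by
  induction cs generalizing c g with
  | nil =>
    rw [show (g && passes w ([] : List (Fin 3 → Literal n))) = g by simp [passes]]
    exact (Exec.loop_exit rfl).cast rfl (by simp)
  | cons d cs ih =>
    have h₀ := (d 0).1.isLt
    have h₁ := (d 1).1.isLt
    have h₂ := (d 2).1.isLt
    obtain ⟨x, l, hx⟩ : ∃ x l, encodeClauses (d :: cs) = x :: l := by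
      rw [encodeClauses_cons]
      cases (d 0).1.val <;> simp [List.replicate_succ]
    have e : Exec (pushOpt .inp (some x) ;; readClause)
        ⟨l, c, a, a', m, m', flat w, [], g :: r, o⟩ (30 * n + 49)
        ⟨encodeClauses cs, (d 2).2 :: false :: (List.replicate (d 2).1 true ++ ((d 1).2 :: false ::
          (List.replicate (d 1).1 true ++ ((d 0).2 :: false ::
            (List.replicate (d 0).1 true ++ c))))), a, a', m, m', flat w, [],
          (g && (test w (d 0).1 (d 0).2 || test w (d 1).1 (d 1).2 || test w (d 2).1 (d 2).2)) :: r,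
          o⟩ := by
      refine (Exec.seq (s₁ := ⟨x :: l, c, a, a', m, m', flat w, [], g :: r, o⟩) (.push _ _ _)
        (?_ : Exec _ _ (30 * n + 48) _)).cast rfl (by omega)
      rw [← hx, encodeClauses_cons]
      exact (Exec.seq (readLiteral_exec (hw.symm ▸ h₀) _ _ _ _ _ _ _ _ _)
        (.seq (readLiteral_exec (hw.symm ▸ h₁) _ _ _ _ _ _ _ _ _)
        (.seq (readLiteral_exec (hw.symm ▸ h₂) _ _ _ _ _ _ _ _ _)
        (.pop (.pop (.pop (.pop (.push _ _ _)))))))).cast rfl (by omega)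
    rw [hx]
    refine (Exec.loop_next rfl e (ih _ _)).cast ?_ ?_
    · rw [← hx, encodeClauses_cons]
      simp [passes, Bool.and_assoc]
    · rw [List.length_cons, add_mul]
      omega

theorem outputValue_exec {n : ℕ} {w : PartialAssignment} (hw : w.length = n)
    (cs : List (Fin 3 → Literal n)) (a a' m m' r o : List Bool) :
    Exec outputValue ⟨encodeClauses cs, [], a, a', m, m', flat w, [], r, o⟩
      (cs.length * (36 * n + 56) + 5)
      ⟨encodeClauses cs, [], a, a', m, m', flat w, [], r, passes w cs :: o⟩ := by
  refine (Exec.seq (.push _ _ _) (.seq (readClauses_exec hw cs _ _ _ _ _ _ _ _)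
    (.seq (moveAll_exec (by decide) _) (.pop (.push _ _ _))))).cast ?_ ?_
  · simp [Store.set, Store.get]
  · have := encodeClauses_length_le cs
    simp only [Store.get, List.append_nil, List.length_reverse]
    nlinarith

/-! ### Loops over the numbers and over the columns -/

/-- Executes `B` for each number `v < N`, where `N` is stored in unary. -/
def forNum (B : StackProg Stk) : StackProg Stk :=
  loop .num Option.isSome (fun _ => push .numDone true ;; B) ;; moveAll .numDone .num

/-- Each round emits `bit` and advances the assignment by `f`, under the invariant `p`. The body
must work for all contents of `num` and `numDone`, since the counter is split between them during
the loop. -/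
theorem forNum_exec {B : StackProg Stk} {t : ℕ} {f : PartialAssignment → PartialAssignment}
    {bit : PartialAssignment → Bool} {p : PartialAssignment → Prop} {i a a' : List Bool}
    (hf : ∀ w, p w → p (f w))
    (hB : ∀ w, p w → ∀ m m' o, Exec B ⟨i, [], a, a', m, m', flat w, [], [], o⟩ t
      ⟨i, [], a, a', m, m', flat (f w), [], [], bit w :: o⟩)
    (N : ℕ) {w : PartialAssignment} (hw : p w) (o : List Bool) :
    Exec (forNum B) ⟨i, [], a, a', List.replicate N true, [], flat w, [], [], o⟩ (N * (t + 4) + 2)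
      ⟨i, [], a, a', List.replicate N true, [], flat (f^[N] w), [], [],
        ((List.range N).map fun v => bit (f^[v] w)).reverse ++ o⟩ := by
  suffices h : ∀ m', Exec (loop .num Option.isSome (fun _ => push .numDone true ;; B))
      ⟨i, [], a, a', List.replicate N true, m', flat w, [], [], o⟩ (N * (t + 2) + 1)
      ⟨i, [], a, a', [], List.replicate N true ++ m', flat (f^[N] w), [], [],
        ((List.range N).map fun v => bit (f^[v] w)).reverse ++ o⟩ by
    refine ((h []).seq (moveAll_exec (by decide) _)).cast ?_ ?_
    · simp [Store.set, Store.get]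
    · simp only [Store.get, List.append_nil, List.length_replicate]
      nlinarith
  induction N generalizing w o with
  | zero => exact fun m' => (Exec.loop_exit rfl).cast rfl (by simp)
  | succ N ih =>
    intro m'
    refine (Exec.loop_next rfl (.seq (.push _ _ _) (hB w hw _ _ _))
      (ih (hf w hw) (bit w :: o) (true :: m'))).cast ?_ ?_
    · simp [replicate_append_cons, List.replicate_succ, List.range_succ_eq_map]
    · nlinarith

/-- Executes `B` for each column, with the index of the column in unary at the top of the input. -/
def forCol (B : StackProg Stk) : StackProg Stk :=
  push .inp false ;; loop .ctr Option.isSome (fun _ => push .ctrDone true ;; B ;; push .inp true) ;;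
    moveAll .ctrDone .ctr ;; loop .inp (· == some true) fun _ => skip

theorem dropTrue_exec (n : ℕ) (i c a a' m m' v v' r o : List Bool) :
    Exec (loop .inp (· == some true) fun _ => skip)
      ⟨List.replicate n true ++ false :: i, c, a, a', m, m', v, v', r, o⟩ (n + 1)
      ⟨i, c, a, a', m, m', v, v', r, o⟩ := by
  induction n with
  | zero => exact .loop_exit rfl
  | succ n ih => exact (Exec.loop_next rfl (.skip _) ih).cast rfl (by omega)

theorem forCol_exec {B : StackProg Stk} {t n : ℕ} {i m w : List Bool} {g : ℕ → List Bool}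
    (hB : ∀ j < n, ∀ a a' o, Exec B
      ⟨List.replicate j true ++ false :: i, [], a, a', m, [], w, [], [], o⟩ t
      ⟨List.replicate j true ++ false :: i, [], a, a', m, [], w, [], [], (g j).reverse ++ o⟩)
    (o : List Bool) :
    Exec (forCol B) ⟨i, [], List.replicate n true, [], m, [], w, [], [], o⟩ (n * (t + 6) + 4)
      ⟨i, [], List.replicate n true, [], m, [], w, [], [],
        ((List.range n).flatMap g).reverse ++ o⟩ := by
  -- `j` columns are done and `d` remain; the index at the top of the input grows with `ctrDone`.
  suffices h : ∀ d j, j + d = n → ∀ o,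
      Exec (loop .ctr Option.isSome (fun _ => push .ctrDone true ;; B ;; push .inp true))
        ⟨List.replicate j true ++ false :: i, [], List.replicate d true, List.replicate j true, m,
          [], w, [], [], o⟩ (d * (t + 3) + 1)
        ⟨List.replicate n true ++ false :: i, [], [], List.replicate n true, m,
          [], w, [], [], ((List.range' j d).flatMap g).reverse ++ o⟩ by
    refine (Exec.seq (.push _ _ _) (.seq (h n 0 (by omega) o) (.seq (moveAll_exec (by decide) _)
      (dropTrue_exec n _ _ _ _ _ _ _ _ _ _)))).cast ?_ ?_
    · simp [Store.set, Store.get, List.range_eq_range']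
    · simp only [Store.get, List.length_replicate]
      nlinarith
  intro d
  induction d with
  | zero =>
    intro j hj o
    obtain rfl : j = n := by omega
    exact (Exec.loop_exit rfl).cast rfl (by simp)
  | succ d ih =>
    intro j hj o
    have e : Exec (push .ctrDone true ;; B ;; push .inp true)
        ⟨List.replicate j true ++ false :: i, [], List.replicate d true, List.replicate j true, m,
          [], w, [], [], o⟩ (1 + (t + 1))
        ⟨List.replicate (j + 1) true ++ false :: i, [], List.replicate d true,
          List.replicate (j + 1) true, m, [], w, [], [], (g j).reverse ++ o⟩ :=
      .seq (.push _ _ _) (.seq (hB j (by omega) _ _ _) (.push _ _ _))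
    refine (Exec.loop_next rfl e (ih (j + 1) (by omega) _)).cast ?_ ?_
    · simp [List.range'_succ]
    · nlinarith

/-! ### Loops with a counter modulo `k` -/

/-- Executes `E r`, …, `E (r + q - 1)`, as far as the counter permits. -/
def cycTail (E : ℕ → StackProg Stk) : ℕ → ℕ → StackProg Stk
  | _, 0 => skip
  | r, q + 1 => pop .ctr fun o => o.elim skip fun _ =>
      push .ctrDone true ;; E r ;; cycTail E (r + 1) q

/-- Executes `E (m % k)` for each `m` less than the counter. -/
def cyc (E : ℕ → StackProg Stk) (k : ℕ) : StackProg Stk :=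
  loop .ctr Option.isSome (fun _ => push .ctrDone true ;; E 0 ;; cycTail E 1 (k - 1)) ;;
    moveAll .ctrDone .ctr

section Cyc

variable {E : ℕ → StackProg Stk} {k n t : ℕ} {i o : List Bool} {num asg : ℕ → List Bool}

/-- The residue is not stored: it is the place reached in the unrolled program. A pass ends either
with an exhausted counter or at a multiple of `k`, where the loop can restart with residue `0`. -/
theorem cycTail_exec
    (hE : ∀ m < n, ∀ a a', Exec (E (m % k)) ⟨i, [], a, a', num m, [], asg m, [], [], o⟩ t
      ⟨i, [], a, a', num (m + 1), [], asg (m + 1), [], [], o⟩)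
    (q r m d : ℕ) (hq : r + q = k) (hr : m % k = r % k) (hd : m + d = n) :
    ∃ e d', d = e + d' ∧ (d' = 0 ∨ (m + e) % k = 0) ∧
      Exec (cycTail E r q) ⟨i, [], List.replicate d true, List.replicate m true, num m, [], asg m,
        [], [], o⟩ (e * (t + 2) + 1) ⟨i, [], List.replicate d' true, List.replicate (m + e) true,
        num (m + e), [], asg (m + e), [], [], o⟩ := by
  induction q generalizing r m d with
  | zero =>
    obtain rfl : r = k := by omega
    exact ⟨0, d, by omega, Or.inr (by simpa using hr), (Exec.skip _).cast rfl (by omega)⟩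
  | succ q ih =>
    rcases d with _ | d
    · exact ⟨0, 0, rfl, Or.inl rfl, (Exec.pop (.skip _)).cast rfl (by omega)⟩
    · obtain ⟨e, d', h₁, h₂, h₃⟩ := ih (r + 1) (m + 1) d (by omega)
        (by rw [Nat.add_mod, hr, ← Nat.add_mod]) (by omega)
      have h := hE m (by omega) (List.replicate d true) (List.replicate (m + 1) true)
      rw [hr, Nat.mod_eq_of_lt (show r < k by omega)] at h
      refine ⟨e + 1, d', by omega, by rwa [show m + (e + 1) = m + 1 + e by omega], ?_⟩
      rw [show m + (e + 1) = m + 1 + e by omega]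
      refine (Exec.pop (.seq (.push _ _ _) (.seq h h₃))).cast rfl ?_
      nlinarith

theorem cyc_exec (hk : 0 < k)
    (hE : ∀ m < n, ∀ a a', Exec (E (m % k)) ⟨i, [], a, a', num m, [], asg m, [], [], o⟩ t
      ⟨i, [], a, a', num (m + 1), [], asg (m + 1), [], [], o⟩) :
    Exec (cyc E k) ⟨i, [], List.replicate n true, [], num 0, [], asg 0, [], [], o⟩
      (n * (t + 5) + 2)
      ⟨i, [], List.replicate n true, [], num n, [], asg n, [], [], o⟩ := by
  suffices h : ∀ d m, m + d = n → (d = 0 ∨ m % k = 0) →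
      Exec (loop .ctr Option.isSome (fun _ => push .ctrDone true ;; E 0 ;; cycTail E 1 (k - 1)))
        ⟨i, [], List.replicate d true, List.replicate m true, num m, [], asg m, [], [], o⟩
        (d * (t + 3) + 1)
        ⟨i, [], [], List.replicate n true, num n, [], asg n, [], [], o⟩ by
    refine ((h n 0 (by omega) (by simp)).seq (moveAll_exec (by decide) _)).cast ?_ ?_
    · simp [Store.set, Store.get]
    · simp only [Store.get, List.length_replicate]
      nlinarith
  intro d
  -- One round of the loop uses up several symbols of the counter, and fewer in the last round.
  induction d using Nat.strong_induction_on with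
  | _ d ih =>
    intro m hm hd
    rcases d with _ | d
    · obtain rfl : m = n := by omega
      exact (Exec.loop_exit rfl).cast rfl (by simp)
    · have hd : m % k = 0 := by omega
      obtain ⟨e, d', h₁, h₂, h₃⟩ := cycTail_exec hE (k - 1) 1 (m + 1) d (by omega)
        (by rw [Nat.add_mod, hd, zero_add, Nat.mod_mod]) (by omega)
      have h := hE m (by omega) (List.replicate d true) (List.replicate (m + 1) true)
      rw [hd] at h
      refine (Exec.loop_next rfl (.seq (.push _ _ _) (.seq h h₃))
        (ih d' (by omega) (m + 1 + e) (by omega) h₂)).cast rfl ?_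
      subst h₁
      nlinarith

end Cyc

/-! ### The program that computes the reduction -/

/-- A row of the tiling instance: one special row, and one row for each triple of residues. -/
abbrev Row : Type := Option (ℕ × ℕ × ℕ)

/-- Whether a variable whose position has the residue `r` is assigned a value in the row. -/
def Row.covers (row : Row) (r : ℕ) : Bool :=
  match row with
  | none => false
  | some (p, q, s) => r == p || r == q || r == s

/-- The rows of the instance. -/
def rows (k : ℕ) : List Row :=
  none :: ((List.range k).product ((List.range k).product (List.range k))).map some

/-- The variables that are assigned a value in a row. -/
def maskList (row : Row) (k : ℕ) : ℕ → List Bool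
  | 0 => []
  | m + 1 => row.covers (m % k) :: maskList row k m

theorem maskList_length (row : Row) (k n : ℕ) : (maskList row k n).length = n := by
  induction n with
  | zero => rfl
  | succ n ih => rw [maskList, List.length_cons, ih]

/-- The first partial assignment with given assigned variables. -/
def zeroOf (l : List Bool) : PartialAssignment :=
  l.map fun b => bif b then (false, true) else (true, true)

/-- The first partial assignment of a row. -/
abbrev rowZero (row : Row) (k n : ℕ) : PartialAssignment := zeroOf (maskList row k n)

theorem rowZero_length (row : Row) (k n : ℕ) : (rowZero row k n).length = n := by
  rw [rowZero, zeroOf, List.length_map, maskList_length]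

/-- Whether the pair of the bit `a` and the partial assignment `w` is allowed in a cell. -/
def cellBit {n : ℕ} (cs : List (Fin 3 → Literal n)) (row : Row) (w : PartialAssignment) (j : ℕ)
    (a : Bool) : Bool :=
  if j < n then test w j a else
    match row with
    | none => !a
    | some _ => a || passes w cs

/-- The encoding of the sets in a cell. -/
def cellBits {n : ℕ} (cs : List (Fin 3 → Literal n)) (k N : ℕ) (row : Row) (j : ℕ) : List Bool :=
  [false, true].flatMap fun a =>
    (List.range N).map fun v => cellBit cs row (next^[v] (rowZero row k n)) j a

/-- Builds the first partial assignment of a row. -/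
def buildZero (row : Row) (k : ℕ) : StackProg Stk :=
  cyc (fun r => bif row.covers r then push .asg true ;; push .asg false
    else push .asg true ;; push .asg true) k

theorem buildZero_exec (row : Row) {k : ℕ} (hk : 0 < k) (n : ℕ) (i m o : List Bool) :
    Exec (buildZero row k) ⟨i, [], List.replicate n true, [], m, [], [], [], [], o⟩
      (n * 7 + 2)
      ⟨i, [], List.replicate n true, [], m, [], flat (rowZero row k n), [], [], o⟩ := by
  refine cyc_exec (t := 2) hk (num := fun _ => m) (asg := fun m => flat (rowZero row k m))
    fun m _ a a' => ?_
  simp only [maskList, zeroOf, List.map_cons, flat]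
  cases row.covers (m % k)
  · exact .seq (.push _ _ _) (.push _ _ _)
  · exact .seq (.push _ _ _) (.push _ _ _)

/-- Outputs the cells of a row, except for the last cell. -/
def outputEntries : StackProg Stk :=
  forCol (forNum (outputEntry false ;; incr) ;; forNum (outputEntry true ;; incr))

/-- Outputs the last cell of a row. -/
def outputLast : Row → StackProg Stk
  | none => forNum (push .out true) ;; forNum (push .out false)
  | some _ => forNum (outputValue ;; incr) ;; forNum (push .out true)

/-- Outputs the cells of a row. -/
def outputRow (k : ℕ) (row : Row) : StackProg Stk :=
  buildZero row k ;; outputEntries ;; outputLast row ;; clear .asg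

section Row

variable {n : ℕ} (cs : List (Fin 3 → Literal n)) {k N : ℕ} {row : Row}

/-- By `hN` each pass over the `N` values returns the counter to its start, so it need not be
rebuilt between the two bits of a cell or between cells. -/
theorem outputEntries_exec (hN : next^[N] (rowZero row k n) = rowZero row k n) (o : List Bool) :
    Exec outputEntries ⟨encodeClauses cs, [], List.replicate n true, [], List.replicate N true, [],
        flat (rowZero row k n), [], [], o⟩ (n * (2 * (N * (20 * n + 29)) + 10) + 4)
      ⟨encodeClauses cs, [], List.replicate n true, [], List.replicate N true, [],
        flat (rowZero row k n), [], [],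
        ((List.range n).flatMap (cellBits cs k N row)).reverse ++ o⟩ := by
  refine (forCol_exec (t := 2 * (N * (20 * n + 29)) + 4) (fun j hj a a' o => ?_) o).cast rfl
    (le_of_eq (by ring))
  have h : ∀ b, ∀ w : PartialAssignment, w.length = n → ∀ m m' o,
      Exec (outputEntry b ;; incr)
        ⟨List.replicate j true ++ false :: encodeClauses cs, [], a, a', m, m', flat w, [], [], o⟩
        (20 * n + 25)
        ⟨List.replicate j true ++ false :: encodeClauses cs, [], a, a', m, m', flat (next w), [],
          [], test w j b :: o⟩ := fun b w hw m m' o =>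
    ((outputEntry_exec (hw.symm ▸ hj) b _ _ _ _ _ _ _).seq (incr_exec w _ _ _ _ _ _ _ _)).cast rfl
      (by omega)
  have h' : ∀ b o, Exec (forNum (outputEntry b ;; incr))
      ⟨List.replicate j true ++ false :: encodeClauses cs, [], a, a', List.replicate N true, [],
        flat (rowZero row k n), [], [], o⟩ (N * (20 * n + 29) + 2)
      ⟨List.replicate j true ++ false :: encodeClauses cs, [], a, a', List.replicate N true, [],
        flat (rowZero row k n), [], [],
        ((List.range N).map fun v => test (next^[v] (rowZero row k n)) j b).reverse ++ o⟩ := by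
    intro b o
    have := forNum_exec (p := fun w => w.length = n) (fun w hw => (next_length w).trans hw) (h b) N
      (rowZero_length row k n) o
    rwa [hN] at this
  refine ((h' false o).seq (h' true _)).cast ?_ (by omega)
  simp [cellBits, cellBit, hj]

theorem outputConst_exec (b : Bool) (i a a' o : List Bool) (w : PartialAssignment) (N : ℕ) :
    Exec (forNum (push .out b)) ⟨i, [], a, a', List.replicate N true, [], flat w, [], [], o⟩
      (N * 5 + 2)
      ⟨i, [], a, a', List.replicate N true, [], flat w, [], [], List.replicate N b ++ o⟩ := by
  refine (forNum_exec (f := id) (bit := fun _ => b) (p := fun _ => True) (fun _ _ => trivial)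
    (fun _ _ _ _ _ => .push _ _ _) N trivial o).cast ?_ le_rfl
  simp

theorem outputLast_exec (hN : next^[N] (rowZero row k n) = rowZero row k n) (o : List Bool) :
    Exec (outputLast row) ⟨encodeClauses cs, [], List.replicate n true, [], List.replicate N true,
        [], flat (rowZero row k n), [], [], o⟩
      (N * (cs.length * (36 * n + 56) + 8 * n + 24) + 4)
      ⟨encodeClauses cs, [], List.replicate n true, [], List.replicate N true, [],
        flat (rowZero row k n), [], [], (cellBits cs k N row n).reverse ++ o⟩ := by
  rcases row with _ | T
  · refine ((outputConst_exec true _ _ _ _ _ N).seq (outputConst_exec false _ _ _ _ _ N)).cast ?_ ?_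
    · simp [cellBits, cellBit]
    · have : N * 10 ≤ N * (cs.length * (36 * n + 56) + 8 * n + 24) :=
        Nat.mul_le_mul_left _ (by omega)
      omega
  · have := forNum_exec (B := outputValue ;; incr) (f := next) (bit := fun w => passes w cs)
      (t := cs.length * (36 * n + 56) + 8 * n + 15) (p := fun w => w.length = n)
      (i := encodeClauses cs) (a := List.replicate n true) (a' := [])
      (fun w hw => (next_length w).trans hw) (fun w hw m m' o =>
      ((outputValue_exec hw cs _ _ _ _ _ _).seq (incr_exec w _ _ _ _ _ _ _ _)).cast rfl
        (by omega)) N (rowZero_length (some T) k n) o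
    rw [hN] at this
    refine (this.seq (outputConst_exec true _ _ _ _ _ N)).cast ?_ ?_
    · simp [cellBits, cellBit]
    · nlinarith

/-- A bound on the time for the output of a row. -/
def rowTime (n N m : ℕ) : ℕ :=
  n * 7 + 2 + (n * (2 * (N * (20 * n + 29)) + 10) + 4 + (N * (m * (36 * n + 56) + 8 * n + 24) + 4 +
    (2 * n + 1)))

theorem outputRow_exec (hk : 0 < k) (hN : next^[N] (rowZero row k n) = rowZero row k n)
    (o : List Bool) :
    Exec (outputRow k row) ⟨encodeClauses cs, [], List.replicate n true, [], List.replicate N true,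
        [], [], [], [], o⟩ (rowTime n N cs.length)
      ⟨encodeClauses cs, [], List.replicate n true, [], List.replicate N true, [], [], [], [],
        ((List.range (n + 1)).flatMap (cellBits cs k N row)).reverse ++ o⟩ := by
  refine ((buildZero_exec row hk n _ _ _).seq ((outputEntries_exec cs hN _).seq
    ((outputLast_exec cs hN _).seq (clear_exec .asg _)))).cast ?_ ?_
  · simp [Store.set, List.range_succ]
  · simp [Store.get, flat_length, rowZero_length, rowTime]

/-- Executes the programs for the rows of a list. -/
def outputRows (k : ℕ) (l : List Row) : StackProg Stk :=
  l.foldr (fun row P => outputRow k row ;; P) skip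

theorem outputRows_exec (hk : 0 < k) (l : List Row)
    (hN : ∀ row ∈ l, next^[N] (rowZero row k n) = rowZero row k n) (o : List Bool) :
    Exec (outputRows k l) ⟨encodeClauses cs, [], List.replicate n true, [], List.replicate N true,
        [], [], [], [], o⟩ (l.length * rowTime n N cs.length)
      ⟨encodeClauses cs, [], List.replicate n true, [], List.replicate N true, [], [], [], [],
        (l.flatMap fun row => (List.range (n + 1)).flatMap (cellBits cs k N row)).reverse ++ o⟩ := by
  induction l generalizing o with
  | nil => exact (Exec.skip _).cast rfl (by simp)
  | cons row l ih =>
    refine ((outputRow_exec cs hk (hN row (by simp)) o).seq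
      (ih (fun r hr => hN r (by simp [hr])) _)).cast ?_ ?_
    · simp
    · rw [List.length_cons, add_mul]
      omega

end Row

/-! ### The header of the instance and the whole program -/

/-- Doubles the number. -/
def double : StackProg Stk :=
  loop .num Option.isSome (fun _ => push .numDone true ;; push .numDone true) ;;
    moveAll .numDone .num

theorem double_exec (N : ℕ) (i c a a' v v' r o : List Bool) :
    Exec double ⟨i, c, a, a', List.replicate N true, [], v, v', r, o⟩ (7 * N + 2)
      ⟨i, c, a, a', List.replicate (2 * N) true, [], v, v', r, o⟩ := by
  suffices h : ∀ m, Exec (loop .num Option.isSome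
      (fun _ => push .numDone true ;; push .numDone true))
      ⟨i, c, a, a', List.replicate N true, m, v, v', r, o⟩ (3 * N + 1)
      ⟨i, c, a, a', [], List.replicate (2 * N) true ++ m, v, v', r, o⟩ by
    refine ((h []).seq (moveAll_exec (by decide) _)).cast ?_ ?_
    · simp [Store.set, Store.get]
    · simp [Store.get]
      omega
  induction N with
  | zero => exact fun m => .loop_exit rfl
  | succ N ih =>
    intro m
    refine (Exec.loop_next rfl (.seq (.push _ _ _) (.push _ _ _)) (ih (true :: true :: m))).cast
      ?_ ?_
    · simp [replicate_append_cons, List.replicate_succ, mul_add]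
    · omega

/-- The number of values in a row of the instance. -/
def numValues (k n : ℕ) : ℕ := 2 ^ (3 * Nat.count (fun m => m % k = 0) n)

theorem numValues_mono (k : ℕ) {m n : ℕ} (h : m ≤ n) : numValues k m ≤ numValues k n :=
  Nat.pow_le_pow_right (by norm_num) (Nat.mul_le_mul_left 3 (Nat.count_monotone _ h))

/-- Computes the number of values. -/
def buildNum (k : ℕ) : StackProg Stk :=
  push .num true ;; cyc (fun r => bif r == 0 then double ;; double ;; double else skip) k

/-- Every index divisible by `k` contributes a factor `8`. Three doublings of `M` cost `7(M + 2M +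
4M) + 6 = 49M + 6`, and `M` never exceeds the final value. -/
theorem buildNum_exec {k : ℕ} (hk : 0 < k) (n : ℕ) (i o : List Bool) :
    Exec (buildNum k) ⟨i, [], List.replicate n true, [], [], [], [], [], [], o⟩
      (n * (49 * numValues k n + 11) + 3)
      ⟨i, [], List.replicate n true, [], List.replicate (numValues k n) true, [], [], [], [], o⟩ := by
  refine (Exec.seq (.push _ _ _) (cyc_exec (t := 49 * numValues k n + 6) hk
    (num := fun m => List.replicate (numValues k m) true) (asg := fun _ => []) (n := n)
    fun m hm a a' => ?_)).cast rfl (le_of_eq (by ring))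
  have hle := numValues_mono k hm.le
  by_cases h : m % k = 0
  · have e : numValues k (m + 1) = 2 * (2 * (2 * numValues k m)) := by
      rw [numValues, Nat.count_succ, if_pos h, numValues, mul_add, pow_add]
      ring
    rw [h, e]
    exact ((double_exec _ _ _ _ _ _ _ _ _).seq ((double_exec _ _ _ _ _ _ _ _ _).seq
      (double_exec _ _ _ _ _ _ _ _ _))).cast rfl (by omega)
  · have e : numValues k (m + 1) = numValues k m := by
      rw [numValues, Nat.count_succ, if_neg h, numValues, add_zero]
    rw [e, show (m % k == 0) = false by simpa using h]
    exact (Exec.skip _).cast rfl (by omega)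

/-- Reads the number of variables. -/
def readNumVars : StackProg Stk :=
  loop .inp (· == some true) fun _ => push .ctr true

theorem readNumVars_exec (n : ℕ) (i o : List Bool) :
    Exec readNumVars ⟨List.replicate n true ++ false :: i, [], [], [], [], [], [], [], [], o⟩
      (2 * n + 1) ⟨i, [], List.replicate n true, [], [], [], [], [], [], o⟩ := by
  suffices h : ∀ a, Exec readNumVars
      ⟨List.replicate n true ++ false :: i, [], a, [], [], [], [], [], [], o⟩
      (2 * n + 1) ⟨i, [], List.replicate n true ++ a, [], [], [], [], [], [], o⟩ by
    simpa using h []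
  induction n with
  | zero => exact fun a => .loop_exit rfl
  | succ n ih =>
    intro a
    refine (Exec.loop_next rfl (.push _ _ _) (ih (true :: a))).cast ?_ (by omega)
    simp [replicate_append_cons, List.replicate_succ]

/-- Outputs the number of variables. -/
def outputNumVars : StackProg Stk :=
  loop .ctr Option.isSome (fun _ => push .ctrDone true ;; push .out true) ;; moveAll .ctrDone .ctr

theorem outputNumVars_exec (n : ℕ) (i o : List Bool) :
    Exec outputNumVars ⟨i, [], List.replicate n true, [], [], [], [], [], [], o⟩ (5 * n + 2)
      ⟨i, [], List.replicate n true, [], [], [], [], [], [], List.replicate n true ++ o⟩ := by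
  suffices h : ∀ a o, Exec (loop .ctr Option.isSome (fun _ => push .ctrDone true ;; push .out true))
      ⟨i, [], List.replicate n true, a, [], [], [], [], [], o⟩ (3 * n + 1)
      ⟨i, [], [], List.replicate n true ++ a, [], [], [], [], [], List.replicate n true ++ o⟩ by
    refine ((h [] o).seq (moveAll_exec (by decide) _)).cast ?_ ?_
    · simp [Store.set, Store.get]
    · simp [Store.get]
      omega
  induction n with
  | zero => exact fun a o => .loop_exit rfl
  | succ n ih =>
    intro a o
    refine (Exec.loop_next rfl (.seq (.push _ _ _) (.push _ _ _)) (ih (true :: a) (true :: o))).cast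
      ?_ (by omega)
    simp [replicate_append_cons, List.replicate_succ]

/-- The program that computes the reduction. -/
def reduction (k : ℕ) : StackProg Stk :=
  readNumVars ;; pushList .out (List.replicate (rows k).length true ++ [false]) ;;
    outputNumVars ;; pushList .out [true, false] ;;
    buildNum k ;; forNum (push .out true) ;; push .out false ;;
    outputRows k (rows k) ;; clear .inp ;; clear .ctr ;; clear .num

/-- A bound on the time of the reduction for a formula with `n` variables and `m` clauses. -/
def reductionTime (k n m : ℕ) : ℕ :=
  (rows k).length * rowTime n (numValues k n) m + m * (3 * n + 3) + 60 * (n + 1) * numValues k n +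
    30 * (n + 1) + (rows k).length

theorem reduction_exec {k : ℕ} (hk : 0 < k) {n : ℕ} (cs : List (Fin 3 → Literal n))
    (hN : ∀ row ∈ rows k, next^[numValues k n] (rowZero row k n) = rowZero row k n) :
    Exec (reduction k)
      ⟨List.replicate n true ++ false :: encodeClauses cs, [], [], [], [], [], [], [], [], []⟩
      (reductionTime k n cs.length)
      ⟨[], [], [], [], [], [], [], [], [],
        (List.replicate (rows k).length true ++ [false] ++ List.replicate (n + 1) true ++ [false] ++
          List.replicate (numValues k n) true ++ [false] ++ (rows k).flatMap fun row =>
            (List.range (n + 1)).flatMap (cellBits cs k (numValues k n) row)).reverse⟩ := by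
  -- The second pushed list, `[true, false]`, turns `n` into `y = n + 1` and adds the delimiter.
  refine (Exec.seq (readNumVars_exec _ _ _) (.seq (pushList_exec _ _ _)
    (.seq (outputNumVars_exec _ _ _) (.seq (pushList_exec _ _ _) (.seq (buildNum_exec hk _ _ _)
    (.seq (outputConst_exec _ _ _ _ _ [] _) (.seq (.push _ _ _)
    (.seq (outputRows_exec cs hk _ hN _) (.seq (clear_exec .inp _) (.seq (clear_exec .ctr _)
      (clear_exec .num _))))))))))).cast ?_ ?_
  · simp [Store.set, Store.get, List.replicate_succ, replicate_append_cons]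
  · have := encodeClauses_length_le cs
    simp only [Store.set, Store.get, reductionTime, List.length_append, List.length_replicate,
      List.length_cons, List.length_nil]
    nlinarith

/-! ### The sequence of partial assignments -/

theorem next_iterate_star (w : PartialAssignment) (v : ℕ) :
    next^[v] ((true, true) :: w) = (true, true) :: next^[v] w := by
  induction v generalizing w with
  | zero => rfl
  | succ v ih => rw [iterate_succ_apply, iterate_succ_apply, next, ih]

/-- The head is the least significant digit: two increments restore it and carry once into the tail.
-/
theorem next_iterate_digit (w : PartialAssignment) (v : ℕ) :
    next^[2 * v] ((false, true) :: w) = (false, true) :: next^[v] w := by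
  induction v generalizing w with
  | zero => rfl
  | succ v ih =>
    rw [mul_add, iterate_add_apply, iterate_succ_apply]
    exact ih (next w)

/-- A counter with `d` digits has period `2 ^ d`, which divides `2 ^ c` for `d ≤ c`. The slack is
needed because all rows share one `N`. -/
theorem next_iterate_zeroOf {l : List Bool} {c : ℕ} (hc : l.count true ≤ c) :
    next^[2 ^ c] (zeroOf l) = zeroOf l := by
  induction l generalizing c with
  | nil => exact iterate_fixed rfl _
  | cons b l ih =>
    cases b
    · rw [List.count_cons_of_ne (by decide)] at hc
      exact (next_iterate_star (zeroOf l) _).trans (congrArg _ (ih hc))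
    · rw [List.count_cons_self] at hc
      obtain ⟨c, rfl⟩ : ∃ c', c = c' + 1 := ⟨c - 1, by omega⟩
      rw [pow_succ']
      exact (next_iterate_digit (zeroOf l) _).trans (congrArg _ (ih (by omega)))

/-- The partial assignment that agrees with `α` on the assigned variables. -/
def assign (α : ℕ → Bool) : List Bool → PartialAssignment
  | [] => []
  | b :: l => (bif b then (α 0, !α 0) else (true, true)) :: assign (fun j => α (j + 1)) l

/-- `v` is the number whose binary digits are the values of `α` at the assigned positions. -/
theorem exists_next_iterate_eq_assign (α : ℕ → Bool) {l : List Bool} {c : ℕ}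
    (hc : l.count true ≤ c) : ∃ v < 2 ^ c, next^[v] (zeroOf l) = assign α l := by
  induction l generalizing c α with
  | nil => exact ⟨0, by positivity, rfl⟩
  | cons b l ih =>
    cases b
    · rw [List.count_cons_of_ne (by decide)] at hc
      obtain ⟨v, hv, h⟩ := ih (fun j => α (j + 1)) hc
      exact ⟨v, hv, (next_iterate_star (zeroOf l) _).trans (congrArg _ h)⟩
    · rw [List.count_cons_self] at hc
      obtain ⟨c, rfl⟩ : ∃ c', c = c' + 1 := ⟨c - 1, by omega⟩
      obtain ⟨v, hv, h⟩ := ih (fun j => α (j + 1)) (c := c) (by omega)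
      have h₀ : next^[2 * v] (zeroOf (true :: l)) = (false, true) :: assign (fun j => α (j + 1)) l :=
        (next_iterate_digit (zeroOf l) _).trans (congrArg _ h)
      rw [pow_succ]
      cases hα : α 0
      · refine ⟨2 * v, by omega, h₀.trans ?_⟩
        simp [assign, hα]
      · refine ⟨2 * v + 1, by omega, ?_⟩
        rw [iterate_succ_apply', h₀]
        simp [assign, hα, next]

theorem test_assign (α : ℕ → Bool) {l : List Bool} {j : ℕ} (hj : j < l.length) :
    test (assign α l) j (α j) = true := by
  induction l generalizing α j with
  | nil => simp at hj
  | cons b l ih =>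
    rcases j with _ | j
    · cases b <;> cases h : α 0 <;> simp [test, assign, allows, h]
    · have := ih (fun j => α (j + 1)) (j := j) (by simpa using hj)
      simpa [test, assign] using this

/-- The partial assignment `w` assigns values exactly to the variables in the list. -/
def Assigns : List Bool → PartialAssignment → Prop :=
  List.Forall₂ fun b e => bif b then e.2 = !e.1 else e = (true, true)

theorem assigns_zeroOf (l : List Bool) : Assigns l (zeroOf l) := by
  induction l with
  | nil => exact .nil
  | cons b l ih => exact .cons (by cases b <;> rfl) ih

theorem Assigns.map_next {l : List Bool} {w : PartialAssignment} (h : Assigns l w) :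
    Assigns l (next w) := by
  induction h with
  | nil => exact .nil
  | @cons b e l w hb h ih =>
    cases b
    · obtain rfl : e = (true, true) := hb
      exact .cons rfl ih
    · obtain ⟨x, y⟩ := e
      obtain rfl : y = !x := hb
      cases x
      · exact .cons rfl h
      · exact .cons rfl ih

theorem assigns_iterate_next (l : List Bool) (v : ℕ) : Assigns l (next^[v] (zeroOf l)) := by
  induction v with
  | zero => exact assigns_zeroOf l
  | succ v ih =>
    rw [iterate_succ_apply']
    exact ih.map_next

/-- An assigned variable allows only one value. This identifies the bit of a column with the sign of
an allowed literal. -/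
theorem Assigns.eq_of_test {l : List Bool} {w : PartialAssignment} (h : Assigns l w) {j : ℕ}
    (hj : l[j]? = some true) {a b : Bool} (ha : test w j a = true) (hb : test w j b = true) :
    a = b := by
  induction h generalizing j with
  | nil => simp at hj
  | @cons c e l w hc h ih =>
    rcases j with _ | j
    · obtain rfl : c = true := by simpa using hj
      obtain ⟨x, y⟩ := e
      obtain rfl : y = !x := hc
      revert ha hb
      cases x <;> cases a <;> cases b <;> simp [test, allows]
    · exact ih (by simpa using hj) (by simpa [test] using ha) (by simpa [test] using hb)

/-! ### The rows -/

theorem count_mod {k p : ℕ} (hp : p < k) (n : ℕ) :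
    Nat.count (fun m => m % k = p) n = n / k + if p < n % k then 1 else 0 := by
  have := Nat.count_modEq_card n (by omega : 0 < k) p
  simp only [Nat.ModEq, Nat.mod_eq_of_lt hp] at this
  exact this

/-- The class of `0` is a largest one, so three times its size bounds the digits of every row. -/
theorem count_mod_le {k p : ℕ} (hp : p < k) (n : ℕ) :
    Nat.count (fun m => m % k = p) n ≤ Nat.count (fun m => m % k = 0) n := by
  rw [count_mod hp, count_mod (show 0 < k by omega)]
  split_ifs <;> omega

theorem count_maskList_le {k : ℕ} {row : Row} (hrow : row ∈ rows k) (n : ℕ) :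
    (maskList row k n).count true ≤ 3 * Nat.count (fun m => m % k = 0) n := by
  rcases row with _ | ⟨p, q, s⟩
  · have : (maskList none k n).count true = 0 := by
      induction n with
      | zero => rfl
      | succ n ih => simpa [maskList, Row.covers] using ih
    omega
  · obtain ⟨hp, hq, hs⟩ : p < k ∧ q < k ∧ s < k := by
      simpa [rows, List.pair_mem_product] using hrow
    have h : (maskList (some (p, q, s)) k n).count true ≤ Nat.count (fun m => m % k = p) n +
        Nat.count (fun m => m % k = q) n + Nat.count (fun m => m % k = s) n := by
      induction n with
      | zero => simp [maskList]
      | succ n ih =>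
        rw [maskList, List.count_cons, Nat.count_succ, Nat.count_succ, Nat.count_succ, Row.covers]
        by_cases h₁ : n % k = p <;> by_cases h₂ : n % k = q <;> by_cases h₃ : n % k = s <;>
          simp [h₁, h₂, h₃] <;> omega
    have h₁ := count_mod_le hp n
    have h₂ := count_mod_le hq n
    have h₃ := count_mod_le hs n
    omega

/-- The assignment is built on a stack, so the entry pushed last is variable `0`; this reverses the
positions. -/
theorem maskList_getElem? (row : Row) (k : ℕ) {n j : ℕ} (hj : j < n) :
    (maskList row k n)[j]? = some (row.covers ((n - 1 - j) % k)) := by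
  induction n generalizing j with
  | zero => omega
  | succ n ih =>
    rcases j with _ | j
    · simp [maskList]
    · rw [maskList, List.getElem?_cons_succ, ih (by omega)]
      congr 3
      omega

/-! ### The tiling instance of a formula -/

/-- The tiling instance of a formula. -/
def tiling (k : ℕ) (φ : ThreeCNF) : NarrowGridTiling where
  x := (rows k).length
  y := φ.numVars + 1
  N := numValues k φ.numVars
  x_pos := by simp [rows]
  y_pos := Nat.succ_pos _
  S i j := Finset.univ.filter fun av => cellBit φ.clauses ((rows k).get i)
    (next^[av.2] (rowZero ((rows k).get i) k φ.numVars)) j av.1 = true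
  nonempty i j := by
    have hN : 0 < numValues k φ.numVars := by unfold numValues; positivity
    suffices h : ∃ a, cellBit φ.clauses ((rows k).get i)
        (rowZero ((rows k).get i) k φ.numVars) j a = true by
      obtain ⟨a, ha⟩ := h
      exact ⟨(a, ⟨0, hN⟩), by simpa using ha⟩
    unfold cellBit
    split_ifs with hj
    · obtain ⟨w₁, e, w₂, hw, -, he⟩ := exists_eq_append_cons
        (hj.trans_eq (rowZero_length ((rows k).get i) k φ.numVars).symm)
      have : e ∈ rowZero ((rows k).get i) k φ.numVars := by rw [hw]; simp
      obtain ⟨b, -, rfl⟩ := List.mem_map.1 this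
      -- In the first partial assignment each variable is either `false` or free.
      refine ⟨false, (he false).trans ?_⟩
      cases b <;> rfl
    · cases (rows k).get i
      · exact ⟨false, rfl⟩
      · exact ⟨true, rfl⟩

theorem tiling_encode (k : ℕ) (φ : ThreeCNF) :
    (tiling k φ).encode =
      List.replicate (rows k).length true ++ [false] ++ List.replicate (φ.numVars + 1) true ++
        [false] ++ List.replicate (numValues k φ.numVars) true ++ [false] ++
        (rows k).flatMap fun row => (List.range (φ.numVars + 1)).flatMap
          (cellBits φ.clauses k (numValues k φ.numVars) row) := by
  unfold NarrowGridTiling.encode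
  congr 1
  conv_rhs => rw [← List.map_get_finRange (rows k), List.flatMap_map]
  refine congrArg (fun f => List.flatMap f (List.finRange (rows k).length)) (funext fun i => ?_)
  rw [← List.map_coe_finRange_eq_range, List.flatMap_map]
  refine congrArg (fun f => List.flatMap f (List.finRange (φ.numVars + 1))) (funext fun j => ?_)
  unfold cellBits
  refine congrArg (fun f => List.flatMap f [false, true]) (funext fun a => ?_)
  rw [← List.map_coe_finRange_eq_range, List.map_map]
  refine congrArg (fun f => List.map f (List.finRange (numValues k φ.numVars))) (funext fun v => ?_)
  refine Bool.eq_iff_iff.2 (decide_eq_true_iff.trans ?_)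
  exact Finset.mem_filter.trans (and_iff_right (Finset.mem_univ _))

theorem tiling_isYes_iff {k : ℕ} (hk : 0 < k) (φ : ThreeCNF) :
    (tiling k φ).IsYes ↔ φ.Satisfiable := by
  constructor
  · rintro ⟨s, hs⟩
    have hcol : ∀ i j, (s i j).1 = (s ⟨0, (tiling k φ).x_pos⟩ j).1 := by
      rintro ⟨i, hi⟩ j
      induction i with
      | zero => rfl
      | succ i ih => exact (hs.vertical ⟨i, by omega⟩ _ j rfl).symm.trans (ih (by omega))
    have hrow : ∀ i j, (s i j).2 = (s i ⟨0, (tiling k φ).y_pos⟩).2 := by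
      rintro i ⟨j, hj⟩
      induction j with
      | zero => rfl
      | succ j ih => exact (hs.horizontal i ⟨j, by omega⟩ _ rfl).symm.trans (ih (by omega))
    obtain ⟨A, hA⟩ : ∃ A : Fin (φ.numVars + 1) → Bool, ∀ i j, (s i j).1 = A j := ⟨_, hcol⟩
    obtain ⟨V, hV⟩ : ∃ V : Fin (rows k).length → Fin (numValues k φ.numVars),
        ∀ i j, (s i j).2 = V i := ⟨_, hrow⟩
    have H : ∀ row ∈ rows k, ∃ v : ℕ, ∀ j : Fin (φ.numVars + 1), cellBit φ.clauses row
        (next^[v] (rowZero row k φ.numVars)) j (A j) = true := by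
      intro row hrow
      obtain ⟨i, rfl⟩ := List.mem_iff_get.1 hrow
      refine ⟨V i, fun j => ?_⟩
      rw [← hA i j, ← hV i j]
      exact (Finset.mem_filter.1 (hs.mem i j)).2
    -- The special row leaves only the bit `false` in the last column, which activates the clause
    -- test in all other rows.
    have hlast : A (Fin.last _) = false := by
      obtain ⟨v, hv⟩ := H none (by simp [rows])
      simpa [cellBit] using hv (Fin.last _)
    refine ⟨fun j => A j.castSucc, fun c hc => ?_⟩
    -- The row that assigns all three variables of the clause `c`.
    obtain ⟨v, hv⟩ := H (some ((φ.numVars - 1 - (c 0).1) % k, (φ.numVars - 1 - (c 1).1) % k,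
      (φ.numVars - 1 - (c 2).1) % k)) (by simp [rows, List.pair_mem_product, Nat.mod_lt _ hk])
    have hpass := hv (Fin.last _)
    simp only [cellBit, Fin.val_last, lt_irrefl, if_false, hlast, Bool.false_or] at hpass
    have hc := List.all_eq_true.1 hpass c hc
    obtain ⟨m, hm⟩ : ∃ m : Fin 3, test (next^[v] (rowZero (some ((φ.numVars - 1 - (c 0).1) % k,
        (φ.numVars - 1 - (c 1).1) % k, (φ.numVars - 1 - (c 2).1) % k)) k φ.numVars))
        (c m).1 (c m).2 = true := by
      rw [Bool.or_eq_true, Bool.or_eq_true] at hc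
      rcases hc with (hc | hc) | hc
      exacts [⟨0, hc⟩, ⟨1, hc⟩, ⟨2, hc⟩]
    -- The row allows the column's bit by the cell in that column and the literal's sign by `hm`, so
    -- the two agree.
    refine ⟨m, (assigns_iterate_next _ _).eq_of_test ?_ ?_ hm⟩
    · rw [maskList_getElem? _ _ (c m).1.isLt]
      fin_cases m <;> simp [Row.covers]
    · have := hv (c m).1.castSucc
      simpa [cellBit] using this
  · rintro ⟨α, hα⟩
    have h : ∀ i : Fin (rows k).length, ∃ v : Fin (numValues k φ.numVars),
        next^[v] (rowZero ((rows k).get i) k φ.numVars) =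
          assign (fun j => if h : j < φ.numVars then α ⟨j, h⟩ else false)
            (maskList ((rows k).get i) k φ.numVars) := by
      intro i
      obtain ⟨v, hv, h⟩ := exists_next_iterate_eq_assign
        (fun j => if h : j < φ.numVars then α ⟨j, h⟩ else false)
        (count_maskList_le (List.get_mem (rows k) i) φ.numVars)
      exact ⟨⟨v, hv⟩, h⟩
    choose V hV using h
    -- The default `false` is the bit required in the last column.
    refine ⟨fun i j => (if h : (j : ℕ) < φ.numVars then α ⟨j, h⟩ else false, V i), ?_, ?_, ?_⟩
    · intro (i : Fin (rows k).length) (j : Fin (φ.numVars + 1))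
      refine Finset.mem_filter.2 ⟨Finset.mem_univ _, ?_⟩
      show cellBit φ.clauses ((rows k).get i)
        (next^[V i] (rowZero ((rows k).get i) k φ.numVars)) j
        (if h : (j : ℕ) < φ.numVars then α ⟨j, h⟩ else false) = true
      rw [hV]
      unfold cellBit
      have htest : ∀ j < φ.numVars, test (assign (fun j => if h : j < φ.numVars then α ⟨j, h⟩
          else false) (maskList ((rows k).get i) k φ.numVars)) j
          (if h : j < φ.numVars then α ⟨j, h⟩ else false) = true := fun j hj =>
        test_assign (fun j => if h : j < φ.numVars then α ⟨j, h⟩ else false)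
          (hj.trans_eq (maskList_length _ _ _).symm)
      generalize (rows k).get i = row at htest ⊢
      split_ifs with hj
      · have := htest j hj
        rwa [dif_pos hj] at this
      · cases row with
        | none => rfl
        | some T =>
          rw [Bool.false_or]
          refine List.all_eq_true.2 fun c hc => ?_
          obtain ⟨m, hm⟩ := hα c hc
          have := htest (c m).1 (c m).1.isLt
          rw [dif_pos (c m).1.isLt, Fin.eta, hm] at this
          rw [Bool.or_eq_true, Bool.or_eq_true]
          fin_cases m
          exacts [Or.inl (Or.inl this), Or.inl (Or.inr this), Or.inr this]
    · intro i i' j _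
      rfl
    · intro i j j' _
      rfl

/-! ### The running time -/

theorem encode_length (k : ℕ) (φ : ThreeCNF) :
    (tiling k φ).encode.length = (rows k).length + 1 + (φ.numVars + 1) + 1 +
      numValues k φ.numVars + 1 +
      (rows k).length * ((φ.numVars + 1) * (2 * numValues k φ.numVars)) := by
  have h : ∀ row j, (cellBits φ.clauses k (numValues k φ.numVars) row j).length =
      2 * numValues k φ.numVars := by
    intro row j
    simp [cellBits]
    ring
  rw [tiling_encode]
  simp [List.length_flatMap, h]
  omega

theorem tiling_reduction {T : NarrowGridTiling → ℝ} {k : ℕ} (hk : 0 < k)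
    (h : SolvableInTime NarrowGridTiling.encode NarrowGridTiling.IsYes T) :
    SolvableInTime ThreeCNF.encode ThreeCNF.Satisfiable fun φ => T (tiling k φ) +
      ((tiling k φ).encode.length + 1 + reductionTime k φ.numVars φ.clauses.length : ℕ) := by
  refine h.of_reduction (tiling k) (tiling_isYes_iff hk) (reduction k) .inp .out
    (fun φ => reductionTime k φ.numVars φ.clauses.length) fun φ => ?_
  have h₁ := reduction_exec hk φ.clauses fun row hrow =>
    next_iterate_zeroOf (count_maskList_le hrow φ.numVars)
  unfold Exec at h₁
  convert h₁ using 1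
  · funext s
    cases s <;> simp [Store.get, ThreeCNF.encode, encodeClauses]
  · rw [tiling_encode]
    funext s
    cases s <;> simp [Store.get]

/-- Distinct clauses are distinct triples of `2n` literals. -/
theorem clauses_length_le (φ : ThreeCNF) : φ.clauses.length ≤ 8 * (φ.numVars + 1) ^ 3 := by
  refine φ.nodup.length_le_card.trans ?_
  simp only [Fintype.card_fun, Fintype.card_prod, Fintype.card_fin, Fintype.card_bool]
  calc (φ.numVars * 2) ^ 3 = 8 * φ.numVars ^ 3 := by ring
    _ ≤ _ := by gcongr; omega

/-- With `Z = n + 1`, the dominant cost is evaluating `O(Z³)` clauses, each in time `O(Z)`, for each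
of the `N` values. All monomials are at most `Z ^ 5 * N`. -/
theorem totalTime_le (k : ℕ) (φ : ThreeCNF) :
    (tiling k φ).encode.length + 1 + reductionTime k φ.numVars φ.clauses.length ≤
      (2000 * (rows k).length + 200) * ((φ.numVars + 1) ^ 5 * numValues k φ.numVars) := by
  have hm := clauses_length_le φ
  have hN : 1 ≤ numValues k φ.numVars := Nat.one_le_two_pow
  rw [encode_length, reductionTime]
  generalize φ.clauses.length = m at *
  generalize numValues k φ.numVars = N at *
  generalize (rows k).length = x at *
  obtain ⟨Z, hZ⟩ : ∃ Z, φ.numVars + 1 = Z := ⟨_, rfl⟩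
  have hZ₁ : 1 ≤ Z := by omega
  have hn : φ.numVars ≤ Z := by omega
  rw [hZ] at hm ⊢
  have hrow : rowTime φ.numVars N m ≤ rowTime Z N (8 * Z ^ 3) := by
    unfold rowTime
    gcongr
  have hpow : ∀ a ≤ 5, Z ^ a ≤ Z ^ 5 * N := fun a ha =>
    (Nat.pow_le_pow_right hZ₁ ha).trans (Nat.le_mul_of_pos_right _ hN)
  have hpow' : ∀ a ≤ 5, Z ^ a * N ≤ Z ^ 5 * N := fun a ha =>
    Nat.mul_le_mul_right _ (Nat.pow_le_pow_right hZ₁ ha)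
  have hrow' : rowTime Z N (8 * Z ^ 3) ≤ 1000 * (Z ^ 5 * N) := by
    have h₀ := hpow 0 (by norm_num)
    have h₁ := hpow 1 (by norm_num)
    have h₂ := hpow' 0 (by norm_num)
    have h₃ := hpow' 1 (by norm_num)
    have h₄ := hpow' 2 (by norm_num)
    have h₅ := hpow' 3 (by norm_num)
    have h₆ := hpow' 4 (by norm_num)
    unfold rowTime
    nlinarith
  have hx := Nat.mul_le_mul_left x (hrow.trans hrow')
  have hx₁ := Nat.mul_le_mul_left x (hpow 0 (by norm_num))
  have hx₂ := Nat.mul_le_mul_left x (hpow' 1 (by norm_num))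
  have hmn : m * (3 * φ.numVars + 3) ≤ 8 * Z ^ 3 * (3 * Z) := by
    rw [show 3 * φ.numVars + 3 = 3 * Z by omega]
    gcongr
  have h₀ := hpow 0 (by norm_num)
  have h₁ := hpow 1 (by norm_num)
  have h₂ := hpow 4 (by norm_num)
  have h₃ := hpow' 0 (by norm_num)
  have h₄ := hpow' 1 (by norm_num)
  nlinarith

/-- The factor `8 = 2 ^ 3` pays for rounding up the sizes of the three classes. -/
theorem numValues_le {k : ℕ} (hk : 0 < k) (n : ℕ) :
    (numValues k n : ℝ) ≤ 8 * (2 : ℝ) ^ ((3 / k : ℝ) * n) := by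
  have h : Nat.count (fun m => m % k = 0) n ≤ n / k + 1 := by
    rw [count_mod hk]
    split_ifs <;> omega
  have h₁ : (Nat.count (fun m => m % k = 0) n : ℝ) ≤ n / k + 1 :=
    (Nat.cast_le.2 h).trans (by push_cast; gcongr; exact Nat.cast_div_le)
  calc (numValues k n : ℝ) = (2 : ℝ) ^ ((3 : ℝ) * Nat.count (fun m => m % k = 0) n) := by
        rw [numValues, Nat.cast_pow, Nat.cast_ofNat, ← Real.rpow_natCast]
        push_cast
        rfl
    _ ≤ (2 : ℝ) ^ (3 + (3 / k : ℝ) * n) := by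
        refine Real.rpow_le_rpow_of_exponent_le one_le_two ?_
        calc _ ≤ 3 * ((n : ℝ) / k + 1) := by gcongr
          _ = _ := by ring
    _ = _ := by
        rw [Real.rpow_add two_pos]
        norm_num

theorem logb_numValues_le (k n : ℕ) : Real.logb 2 (numValues k n) ≤ 3 * n := by
  rw [numValues]
  push_cast
  rw [Real.logb_pow, Real.logb_self_eq_one one_lt_two, mul_one]
  exact_mod_cast Nat.mul_le_mul_left 3 (Nat.count_le (p := fun m => m % k = 0) (n := n))

theorem exists_pow_le (p : ℕ) {η : ℝ} (hη : 0 < η) :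
    ∃ C : ℝ, 0 < C ∧ ∀ n : ℕ, ((n : ℝ) + 1) ^ p ≤ C * (2 : ℝ) ^ (η * n) := by
  have h := (isLittleO_pow_const_const_pow_of_one_lt (R := ℝ) p
    (Real.one_lt_rpow one_lt_two hη)).isBigO
  obtain ⟨C, hC, h⟩ := Asymptotics.bound_of_isBigO_nat_atTop h
  -- The asymptotic bound is used at `n + 1`, hence the extra `2 ^ η`.
  refine ⟨C * 2 ^ η, by positivity, fun n => ?_⟩
  have := h (x := n + 1) (by positivity)
  rw [Real.norm_of_nonneg (by positivity), Real.norm_of_nonneg (by positivity), pow_succ',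
    ← Real.rpow_mul_natCast zero_le_two] at this
  push_cast at this
  linarith

end GridReduction

/-! ### Choice of the parameters and conclusion -/

open GridReduction

theorem narrowGridTiling_lower_bound (hETH : ExponentialTimeHypothesis) (b : ℝ) (hb : 0 < b) :
    ∃ ε : ℝ, 0 < ε ∧ ∀ C : ℝ, 0 < C →
      ¬ SolvableInTime NarrowGridTiling.encode NarrowGridTiling.IsYes fun I =>
          C * (2 : ℝ) ^ (ε * ((I.x : ℝ) * (I.y : ℝ) + (I.x : ℝ) ^ 2 * Real.logb 2 (I.N : ℝ))) *
            (I.N : ℝ) ^ b := by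
  obtain ⟨δ, hδ, hETH⟩ := hETH
  -- With `b + 1` the same `k` serves both `N ^ b`, from the solver, and `N`, from writing the
  -- instance.
  obtain ⟨k, hk⟩ := exists_nat_gt (12 * (b + 1) / δ)
  have hk₀ : 0 < (k : ℝ) := lt_trans (by positivity) hk
  have hk₁ : 0 < k := by exact_mod_cast hk₀
  have hkδ : 3 / k * (b + 1) ≤ δ / 4 := by
    rw [div_lt_iff₀ hδ] at hk
    rw [div_mul_eq_mul_div, div_le_iff₀ hk₀]
    linarith
  obtain ⟨x, hx⟩ : ∃ x : ℝ, ((rows k).length : ℝ) = x := ⟨_, rfl⟩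
  have hx₁ : 1 ≤ x := by
    rw [← hx]
    exact_mod_cast (show 1 ≤ (rows k).length by simp [rows])
  -- Since `log₂ N ≤ 3n`, the quantity `xy + x² log₂ N` is at most `(x + 6x²)(n + 1)`, so this `ε`
  -- gives an exponent of at most `δ(n + 1)/4`.
  refine ⟨δ / (4 * (x + 6 * x ^ 2)), by positivity, fun C hC hsolv => hETH ?_⟩
  obtain ⟨C₁, hC₁, hpoly⟩ := exists_pow_le 5 (η := δ / 4) (by positivity)
  refine ⟨C * 2 ^ (δ / 4) * 8 ^ b + (2000 * x + 200) * C₁ * 8,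
    (tiling_reduction hk₁ hsolv).mono fun φ => ?_⟩
  have hN := numValues_le hk₁ φ.numVars
  have hk₂ : 3 / k ≤ δ / 4 := le_trans (le_mul_of_one_le_right (by positivity) (by linarith)) hkδ
  have hk₃ : 3 / k * b ≤ δ / 4 :=
    le_trans (mul_le_mul_of_nonneg_left (by linarith) (by positivity)) hkδ
  have hn : (0 : ℝ) ≤ φ.numVars := Nat.cast_nonneg _
  rw [add_mul]
  refine add_le_add ?_ ?_
  · have hlog := logb_numValues_le k φ.numVars
    have hexp : δ / (4 * (x + 6 * x ^ 2)) * (x * ((φ.numVars : ℝ) + 1) +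
        x ^ 2 * Real.logb 2 (numValues k φ.numVars)) ≤ δ / 4 * (φ.numVars + 1) := by
      calc _ ≤ δ / (4 * (x + 6 * x ^ 2)) * ((x + 6 * x ^ 2) * (φ.numVars + 1)) := by
            refine mul_le_mul_of_nonneg_left ?_ (by positivity)
            have := mul_le_mul_of_nonneg_left hlog (sq_nonneg x)
            nlinarith [mul_nonneg (sq_nonneg x) hn]
        _ = _ := by
            field_simp
    calc C * (2 : ℝ) ^ (δ / (4 * (x + 6 * x ^ 2)) * (((rows k).length : ℝ) *
            ((φ.numVars + 1 : ℕ) : ℝ) + ((rows k).length : ℝ) ^ 2 *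
              Real.logb 2 (numValues k φ.numVars))) * (numValues k φ.numVars : ℝ) ^ b
        ≤ C * (2 : ℝ) ^ (δ / 4 * (φ.numVars + 1)) *
            (8 * (2 : ℝ) ^ ((3 / k : ℝ) * φ.numVars)) ^ b := by
          rw [hx, Nat.cast_add, Nat.cast_one]
          gcongr
          exact one_le_two
      _ = C * 2 ^ (δ / 4) * 8 ^ b * (2 : ℝ) ^ ((δ / 4 + 3 / k * b) * φ.numVars) := by
          rw [Real.mul_rpow (by norm_num) (by positivity), ← Real.rpow_mul zero_le_two, mul_add,
            Real.rpow_add two_pos, add_mul, Real.rpow_add two_pos, mul_one,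
            mul_right_comm (3 / (k : ℝ))]
          ring
      _ ≤ _ := by
          gcongr
          · exact one_le_two
          · linarith
  · calc (((tiling k φ).encode.length + 1 + reductionTime k φ.numVars φ.clauses.length : ℕ) : ℝ)
        ≤ (2000 * x + 200) * (((φ.numVars : ℝ) + 1) ^ 5 * numValues k φ.numVars) := by
          rw [← hx]
          exact_mod_cast totalTime_le k φ
      _ ≤ (2000 * x + 200) * ((C₁ * 2 ^ (δ / 4 * φ.numVars)) *
            (8 * (2 : ℝ) ^ ((3 / k : ℝ) * φ.numVars))) := by
          gcongr
          exact hpoly φ.numVars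
      _ = (2000 * x + 200) * C₁ * 8 * (2 : ℝ) ^ ((δ / 4 + 3 / k) * φ.numVars) := by
          rw [add_mul (δ / 4), Real.rpow_add two_pos]
          ring
      _ ≤ _ := by
          gcongr
          · exact one_le_two
          · linarith

theorem mainTheorem10 (hETH : ExponentialTimeHypothesis) :
    (∀ b : ℝ, 0 < b → ∃ ε : ℝ, 0 < ε ∧ ∀ C : ℝ, 0 < C →
      ¬ SolvableInTime NarrowGridTiling.encode NarrowGridTiling.IsYes fun I =>
          C * (2 : ℝ) ^ (ε * ((I.x : ℝ) * (I.y : ℝ) + (I.x : ℝ) ^ 2 * Real.logb 2 (I.N : ℝ))) *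
            (I.N : ℝ) ^ b) ∧
    (∀ (f : ℕ → ℝ) (b : ℝ),
      Asymptotics.IsLittleO Filter.atTop f (fun s : ℕ => (s : ℝ)) →
      ¬ SolvableInTime NarrowGridTiling.encode NarrowGridTiling.IsYes fun I =>
          (2 : ℝ) ^ f (I.x * I.y) * (I.N : ℝ) ^ b) := by
  refine ⟨narrowGridTiling_lower_bound hETH, fun f b hf hsolv => ?_⟩
  -- Part (1) needs a positive exponent; enlarging `b` is harmless because `N ≥ 1`.
  obtain ⟨ε, hε, h⟩ := narrowGridTiling_lower_bound hETH (max b 1) (by positivity)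
  have hO : (fun s : ℕ => (2 : ℝ) ^ f s) =O[Filter.atTop] fun s : ℕ => (2 : ℝ) ^ (ε * s) := by
    refine Asymptotics.IsBigO.of_bound 1 ?_
    filter_upwards [hf.bound hε] with s hs
    rw [Real.norm_of_nonneg (by positivity), Real.norm_of_nonneg (by positivity), one_mul]
    refine Real.rpow_le_rpow_of_exponent_le one_le_two ((Real.le_norm_self _).trans (hs.trans ?_))
    rw [Real.norm_natCast]
  -- Since `2 ^ (εs)` never vanishes, a constant absorbs the finitely many small `s`, and the bound
  -- holds for all `s`.
  obtain ⟨C, hC, hO⟩ := Asymptotics.bound_of_isBigO_nat_atTop hO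
  refine h C hC (hsolv.mono fun I => ?_)
  have hN : (1 : ℝ) ≤ I.N := by
    obtain ⟨p, -⟩ := I.nonempty ⟨0, I.x_pos⟩ ⟨0, I.y_pos⟩
    exact_mod_cast p.2.pos
  have h₁ := hO (x := I.x * I.y) (by positivity)
  rw [Real.norm_of_nonneg (by positivity), Real.norm_of_nonneg (by positivity)] at h₁
  have hlog : 0 ≤ Real.logb 2 I.N := Real.logb_nonneg one_lt_two hN
  refine mul_le_mul (h₁.trans ?_) (Real.rpow_le_rpow_of_exponent_le hN (le_max_left _ _))
    (by positivity) (by positivity)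
  push_cast
  gcongr
  · exact one_le_two
  · exact le_add_of_nonneg_right (by positivity)
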